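/- Let $q\in\mathbb{C}$ be such that $q^2$ has finite multiplicative order $\ell\ge 3$. For $n\ge 0$ let $\mathrm{TL}_n(q)$ be the Temperley–Lieb algebra: the associative unital $\mathbb{C}$-algebra with generators $f_1,\dots,f_{n-1}$ and relations $f_i^2=-(q+q^{-1})f_i$ for all $i$, $f_if_{i\pm1}f_i=f_i$ whenever both indices occur, and $f_if_j=f_jf_i$ if $|i-j|\ge 2$. Then $\mathrm{TL}_{\ell-1}(q)$ contains a unique nonzero idempotent $E_{\ell-1}$ with $f_iE_{\ell-1}=E_{\ell-1}f_i=0$ for $1\le i\le \ell-2$ (the Jones–Wenzl idempotent). For $n\ge\ell-1$ let $R_n$ be the two-sided ideal of $\mathrm{TL}_n(q)$ generated by the image of $E_{\ell-1}$ under the homomorphism $\mathrm{TL}_{\ell-1}(q)\to\mathrm{TL}_n(q)$, $f_i\mapsto f_i$, and for $n<\ell-1$ let $R_n=0$. Let $Q_n(\ell)=\mathrm{TL}_n(q)/R_n$ be the Jones algebra. Define $p_i(x)\in\mathbb{Z}[x]$, $i\ge 1$, by $p_1(x)=p_2(x)=1$ and $p_{i+1}(x)=p_i(x)-x\,p_{i-1}(x)$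 for $i\ge 2$. Then every $Q_n(\ell)$ is finite-dimensional over $\mathbb{C}$, and, as formal power series in $x$, $$\sum_{n=0}^{\infty}\dim_{\mathbb{C}}\bigl(Q_{n+1}(\ell)\bigr)\,x^n=\frac{p_{\ell-2}(x)}{p_\ell(x)}.$$ -/

import Mathlib

open scoped Polynomial PowerSeries

namespace TemperleyLieb

/-- The defining relations of the Temperley-Lieb algebra on `n` strings. The generators
`f_1, …, f_{n-1}` are indexed from zero: `f_{i+1}` is `FreeAlgebra.ι ℂ i`. -/
inductive Rel (q : ℂ) (n : ℕ) :
    FreeAlgebra ℂ (Fin (n - 1)) → FreeAlgebra ℂ (Fin (n - 1)) → Prop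
  | sq (i : Fin (n - 1)) :
      Rel q n (FreeAlgebra.ι ℂ i * FreeAlgebra.ι ℂ i) ((-(q + q⁻¹)) • FreeAlgebra.ι ℂ i)
  | braid (i j : Fin (n - 1)) (h : (i : ℕ) + 1 = j ∨ (j : ℕ) + 1 = i) :
      Rel q n (FreeAlgebra.ι ℂ i * FreeAlgebra.ι ℂ j * FreeAlgebra.ι ℂ i) (FreeAlgebra.ι ℂ i)
  | comm (i j : Fin (n - 1)) (h : (i : ℕ) + 2 ≤ j ∨ (j : ℕ) + 2 ≤ i) :
      Rel q n (FreeAlgebra.ι ℂ i * FreeAlgebra.ι ℂ j) (FreeAlgebra.ι ℂ j * FreeAlgebra.ι ℂ i)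

/-- The Temperley-Lieb algebra `TL_n(q)` over `ℂ`. -/
abbrev TL (q : ℂ) (n : ℕ) : Type := RingQuot (Rel q n)

/-- The generators of `TL_n(q)`. -/
noncomputable def gen (q : ℂ) (n : ℕ) (i : Fin (n - 1)) : TL q n :=
  RingQuot.mkAlgHom ℂ (Rel q n) (FreeAlgebra.ι ℂ i)

theorem gen_sq (q : ℂ) (n : ℕ) (i : Fin (n - 1)) :
    gen q n i * gen q n i = (-(q + q⁻¹)) • gen q n i := by
  have h := RingQuot.mkAlgHom_rel ℂ (Rel.sq (q := q) (n := n) i)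
  rwa [map_mul, map_smul] at h

theorem gen_braid (q : ℂ) (n : ℕ) (i j : Fin (n - 1))
    (hij : (i : ℕ) + 1 = j ∨ (j : ℕ) + 1 = i) :
    gen q n i * gen q n j * gen q n i = gen q n i := by
  have h := RingQuot.mkAlgHom_rel ℂ (Rel.braid (q := q) (n := n) i j hij)
  rwa [map_mul, map_mul] at h

theorem gen_comm (q : ℂ) (n : ℕ) (i j : Fin (n - 1))
    (hij : (i : ℕ) + 2 ≤ j ∨ (j : ℕ) + 2 ≤ i) :
    gen q n i * gen q n j = gen q n j * gen q n i := by
  have h := RingQuot.mkAlgHom_rel ℂ (Rel.comm (q := q) (n := n) i j hij)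
  rwa [map_mul, map_mul] at h

/-- The canonical homomorphism `TL_m(q) → TL_n(q)` for `m ≤ n`, sending `f_i` to `f_i`. -/
noncomputable def incl (q : ℂ) {m n : ℕ} (h : m ≤ n) : TL q m →ₐ[ℂ] TL q n :=
  RingQuot.liftAlgHom ℂ
    ⟨FreeAlgebra.lift ℂ (fun i : Fin (m - 1) => gen q n (Fin.castLE (Nat.sub_le_sub_right h 1) i)),
      by
        intro x y hxy
        cases hxy with
        | sq i => simpa using gen_sq q n _
        | braid i j hij => simpa using gen_braid q n _ _ (by simpa using hij)
        | comm i j hij => simpa using gen_comm q n _ _ (by simpa using hij)⟩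

theorem incl_gen (q : ℂ) {m n : ℕ} (h : m ≤ n) (i : Fin (m - 1)) :
    incl q h (gen q m i) = gen q n (Fin.castLE (Nat.sub_le_sub_right h 1) i) := by
  simp [incl, gen]

/-- `E` is a Jones-Wenzl idempotent of `TL_n(q)`: a nonzero idempotent which is killed by every
generator on both sides. -/
structure IsJonesWenzl (q : ℂ) (n : ℕ) (E : TL q n) : Prop where
  ne_zero : E ≠ 0
  idem : E * E = E
  gen_mul : ∀ i, gen q n i * E = 0
  mul_gen : ∀ i, E * gen q n i = 0

/-- The two-sided ideal `R_n` of `TL_n(q)` generated by the image of the Jones-Wenzl idempotent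
`E_{ℓ-1}` of `TL_{ℓ-1}(q)` if `n ≥ ℓ - 1`. For `n < ℓ - 1` it is the zero ideal. -/
noncomputable def jonesIdeal (q : ℂ) (l n : ℕ) : TwoSidedIdeal (TL q n) :=
  TwoSidedIdeal.span
    {x | ∃ (h : l - 1 ≤ n) (E : TL q (l - 1)), IsJonesWenzl q (l - 1) E ∧ incl q h E = x}

/-- The Jones algebra `Q_n(ℓ) = TL_n(q) / R_n`. -/
abbrev JonesAlgebra (q : ℂ) (l n : ℕ) : Type := TL q n ⧸ (jonesIdeal q l n).asIdeal

/-- The polynomials `p_i`, `i ≥ 1`, given by `p_1 = p_2 = 1` and `p_{i+1} = p_i - x p_{i-1}`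
for `i ≥ 2`. The value at index `0` is a placeholder. -/
noncomputable def p : ℕ → ℤ[X]
  | 0 => 0
  | 1 => 1
  | 2 => 1
  | (i + 3) => p (i + 2) - Polynomial.X * p (i + 1)

/-- The polynomial `p_i`, regarded as a formal power series over `ℚ`. -/
noncomputable def pSeries (i : ℕ) : ℚ⟦X⟧ := ((p i).map (Int.castRingHom ℚ) : ℚ[X])

/-- For `i ≥ 1` the power series `p_i` is invertible. -/
theorem constantCoeff_pSeries (i : ℕ) : PowerSeries.constantCoeff (pSeries (i + 1)) = 1 := by
  have key : ∀ i, (p (i + 1)).coeff 0 = 1 := by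
    intro i
    induction i with
    | zero => simp [p]
    | succ k ih =>
      cases k with
      | zero => simp [p]
      | succ k => simp [p, ih]
  rw [pSeries, ← PowerSeries.coeff_zero_eq_constantCoeff_apply, Polynomial.coeff_coe,
    Polynomial.coeff_map, key, map_one]

end TemperleyLieb

/-! Put `L = l - 1`. The quantum integers $[1],\dots,[L]$ are nonzero while $[L+1]=[\ell]=0$, so
$a\mapsto[a+1]$ is a nowhere vanishing eigenvector, with eigenvalue $q+q^{-1}$, of the adjacency
matrix of the path graph on $0,\dots,L-1$. Such a vector makes the Temperley–Lieb algebra act on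
functions of walks from $0$ on this graph (`isTLFamily_pathOp`). The image of $\mathrm{TL}_n$ has as
basis the matrix units indexed by pairs of walks of length $n$ with a common endpoint
(`toSubmodule_strands_pathOp`, `linearIndependent_matUnits`).

The image is exactly the Jones algebra. In the path model on $L$ strands the identity is already a
combination of products through the last generator, because no walk of length $L$ goes straight up;
such products annihilate the Jones–Wenzl element, which therefore acts as zero (`pathRep_incl`).
Conversely, any Temperley–Lieb family in which $1$ is such a combination on $L$ strands is
represented faithfully (`eq_zero_of_map_eq_zero`). The quotient is of this kind, since $E-1$ is a
combination of these products and $E$ becomes zero. Faithfulness is proved by induction on the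
number of strands: a kernel element annihilates all products through the last generator. Below $L$
strands the Jones–Wenzl idempotent then kills it, and from $L$ strands on multiplication by $1$
does.

Hence $\dim Q_n$ is the number of closed walks of length $2n$ at $0$. Solving the three-term
recursion for walk generating functions, with zero boundary value at $L$, gives the quotient of the
$p_i$ (`mk_walkCount`).

Existence of the idempotent is Wenzl's recursion (`wenzl_aux`); uniqueness holds because two such
elements are proportional (`exists_isJonesWenzl`). -/

open scoped PowerSeries

namespace TemperleyLieb

/-! ### Families satisfying the Temperley-Lieb relations -/

section Generic

variable {A : Type*} [Ring A] [Algebra ℂ A]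

/-- The elements `f 0, …, f (N - 2)` satisfy the Temperley-Lieb relations on `N` strings with
loop parameter `-d`. -/
structure IsTLFamily (d : ℂ) (N : ℕ) (f : ℕ → A) : Prop where
  sq : ∀ i, i + 2 ≤ N → f i * f i = (-d) • f i
  braid_up : ∀ i, i + 3 ≤ N → f i * f (i + 1) * f i = f i
  braid_down : ∀ i, i + 3 ≤ N → f (i + 1) * f i * f (i + 1) = f (i + 1)
  comm : ∀ i j, i + 2 ≤ j → j + 2 ≤ N → f i * f j = f j * f i

/-- The subalgebra generated by the first `k - 1` members of a family. -/
def strands (f : ℕ → A) (k : ℕ) : Subalgebra ℂ A := Algebra.adjoin ℂ (f '' {i | i + 2 ≤ k})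

/-- The span of the products `x * f (k - 2) * y`, where `x` and `y` lie in the subalgebra
generated by the first `k - 2` members of the family. -/
def bridge (f : ℕ → A) (k : ℕ) : Submodule ℂ A :=
  Submodule.span ℂ {z | ∃ i x y, i + 2 = k ∧ x ∈ strands f (i + 1) ∧ y ∈ strands f (i + 1) ∧
    z = x * f i * y}

variable {d : ℂ} {N : ℕ} {f : ℕ → A}

theorem strands_mono {k m : ℕ} (h : k ≤ m) : strands f k ≤ strands f m :=
  Algebra.adjoin_mono (Set.image_mono fun _ hi => le_trans hi h)

theorem mem_strands {i k : ℕ} (h : i + 2 ≤ k) : f i ∈ strands f k :=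
  Algebra.subset_adjoin ⟨i, h, rfl⟩

theorem mem_bridge {n : ℕ} {x y : A} (hx : x ∈ strands f (n + 1)) (hy : y ∈ strands f (n + 1)) :
    x * f n * y ∈ bridge f (n + 2) :=
  Submodule.subset_span ⟨n, x, y, rfl, hx, hy, rfl⟩

theorem bridge_induction {n : ℕ} {p : A → Prop} (h0 : p 0) (hadd : ∀ x y, p x → p y → p (x + y))
    (hsmul : ∀ (c : ℂ) x, p x → p (c • x))
    (h : ∀ x ∈ strands f (n + 1), ∀ y ∈ strands f (n + 1), p (x * f n * y))
    {z : A} (hz : z ∈ bridge f (n + 2)) : p z := by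
  refine Submodule.span_induction ?_ h0 (fun x y _ _ => hadd x y) (fun c x _ => hsmul c x) hz
  rintro z ⟨i, x, y, hi, hx, hy, rfl⟩
  obtain rfl : i = n := by omega
  exact h x hx y hy

theorem bridge_le_strands (k : ℕ) : bridge f k ≤ Subalgebra.toSubmodule (strands f k) := by
  refine Submodule.span_le.2 ?_
  rintro z ⟨i, x, y, rfl, hx, hy, rfl⟩
  exact (strands f (i + 2)).mul_mem ((strands f (i + 2)).mul_mem
    (strands_mono (by omega) hx) (mem_strands le_rfl)) (strands_mono (by omega) hy)

theorem strands_of_le_one {k : ℕ} (hk : k ≤ 1) : strands f k = ⊥ := by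
  rw [strands, show f '' {i | i + 2 ≤ k} = ∅ by
    rw [Set.image_eq_empty, Set.eq_empty_iff_forall_notMem]
    intro i (hi : i + 2 ≤ k)
    omega, Algebra.adjoin_empty]

theorem exists_eq_smul_of_le_one {k : ℕ} (hk : k ≤ 1) {b : A} (hb : b ∈ strands f k) :
    ∃ c : ℂ, b = c • (1 : A) := by
  rw [strands_of_le_one hk, Algebra.mem_bot] at hb
  obtain ⟨c, rfl⟩ := hb
  exact ⟨c, Algebra.algebraMap_eq_smul_one c⟩

theorem map_strands {A' : Type*} [Ring A'] [Algebra ℂ A'] (g : A →ₐ[ℂ] A') {f' : ℕ → A'} {k : ℕ}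
    (hg : ∀ i, i + 2 ≤ k → g (f i) = f' i) : (strands f k).map g = strands f' k := by
  rw [strands, AlgHom.map_adjoin, Set.image_image, strands]
  exact congrArg _ (Set.image_congr fun i hi => hg i hi)

theorem map_mem_strands {A' : Type*} [Ring A'] [Algebra ℂ A'] (g : A →ₐ[ℂ] A') {f' : ℕ → A'}
    {k : ℕ} (hg : ∀ i, i + 2 ≤ k → g (f i) = f' i) {x : A} (hx : x ∈ strands f k) :
    g x ∈ strands f' k :=
  map_strands g hg ▸ Subalgebra.mem_map.2 ⟨x, hx, rfl⟩

theorem map_mem_bridge {A' : Type*} [Ring A'] [Algebra ℂ A'] (g : A →ₐ[ℂ] A') {f' : ℕ → A'}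
    {k : ℕ} (hg : ∀ i, i + 2 ≤ k → g (f i) = f' i) {z : A} (hz : z ∈ bridge f k) :
    g z ∈ bridge f' k := by
  suffices h : bridge f k ≤ (bridge f' k).comap g.toLinearMap from h hz
  refine Submodule.span_le.2 ?_
  rintro z ⟨i, x, y, rfl, hx, hy, rfl⟩
  simp only [Submodule.comap_coe, Set.mem_preimage, AlgHom.toLinearMap_apply, map_mul,
    hg i le_rfl, SetLike.mem_coe]
  exact mem_bridge (map_mem_strands g (fun j hj => hg j (by omega)) hx)
    (map_mem_strands g (fun j hj => hg j (by omega)) hy)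

/-- An element annihilated by the generators on the left spans a line stable under
multiplication. -/
theorem exists_mul_eq_smul {k : ℕ} {E b : A} (hE : ∀ i, i + 2 ≤ k → f i * E = 0)
    (hb : b ∈ strands f k) : ∃ c : ℂ, b * E = c • E := by
  refine Algebra.adjoin_induction (p := fun b _ => ∃ c : ℂ, b * E = c • E) ?_ ?_ ?_ ?_ hb
  · rintro _ ⟨i, hi, rfl⟩
    exact ⟨0, by rw [hE i hi, zero_smul]⟩
  · exact fun c => ⟨c, by rw [Algebra.smul_def]⟩
  · rintro x y _ _ ⟨c, hc⟩ ⟨c', hc'⟩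
    exact ⟨c + c', by rw [add_mul, hc, hc', add_smul]⟩
  · rintro x y _ _ ⟨c, hc⟩ ⟨c', hc'⟩
    exact ⟨c' * c, by rw [mul_assoc, hc', mul_smul_comm, hc, mul_smul]⟩

/-- An element annihilated by the generators on the right spans a line stable under
multiplication. -/
theorem exists_mul_eq_smul' {k : ℕ} {E b : A} (hE : ∀ i, i + 2 ≤ k → E * f i = 0)
    (hb : b ∈ strands f k) : ∃ c : ℂ, E * b = c • E := by
  refine Algebra.adjoin_induction (p := fun b _ => ∃ c : ℂ, E * b = c • E) ?_ ?_ ?_ ?_ hb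
  · rintro _ ⟨i, hi, rfl⟩
    exact ⟨0, by rw [hE i hi, zero_smul]⟩
  · exact fun c => ⟨c, by rw [← Algebra.commutes, Algebra.smul_def]⟩
  · rintro x y _ _ ⟨c, hc⟩ ⟨c', hc'⟩
    exact ⟨c + c', by rw [mul_add, hc, hc', add_smul]⟩
  · rintro x y _ _ ⟨c, hc⟩ ⟨c', hc'⟩
    exact ⟨c * c', by rw [← mul_assoc, hc, smul_mul_assoc, hc', mul_smul]⟩

/-- In `x * f i * y * E` the factor `y` acts on `E` as a scalar, and then `f i` kills it. Applied to
`z = E' - 1` this gives uniqueness of the idempotent; applied to `z = 1` it forces `E = 0`. -/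
theorem bridge_mul_eq_zero {k : ℕ} {E z : A} (hE : ∀ i, i + 2 ≤ k → f i * E = 0)
    (hz : z ∈ bridge f k) : z * E = 0 := by
  suffices h : bridge f k ≤ LinearMap.ker (LinearMap.mulRight ℂ E) from h hz
  refine Submodule.span_le.2 ?_
  rintro z ⟨i, x, y, rfl, hx, hy, rfl⟩
  obtain ⟨c, hc⟩ := exists_mul_eq_smul (fun j hj => hE j (by omega)) hy
  simp [mul_assoc, hc, hE i le_rfl]

/-! ### Reduction modulo the last generator, and Wenzl's recursion -/

namespace IsTLFamily

variable (hf : IsTLFamily d N f)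
include hf

theorem commute_of_mem {n : ℕ} (hn : n + 2 ≤ N) {x : A} (hx : x ∈ strands f n) :
    x * f n = f n * x := by
  refine Algebra.adjoin_induction (p := fun x _ => x * f n = f n * x) ?_ ?_ ?_ ?_ hx
  · rintro _ ⟨i, hi, rfl⟩
    exact hf.comm i n hi hn
  · exact fun c => Algebra.commutes c _
  · intro x y _ _ hx hy
    rw [add_mul, mul_add, hx, hy]
  · intro x y _ _ hx hy
    rw [mul_assoc, hy, ← mul_assoc, hx, mul_assoc]

/-- The relation `f i = f i * f (i + 1) * f i` exhibits the old last generator as a product through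
the new one. -/
theorem bridge_mono_succ {k : ℕ} (hk : k + 1 ≤ N) : bridge f k ≤ bridge f (k + 1) := by
  refine Submodule.span_le.2 ?_
  rintro z ⟨i, x, y, rfl, hx, hy, rfl⟩
  have h := mem_bridge (f := f) (n := i + 1) (x := x * f i) (y := f i * y)
    (mul_mem (strands_mono (by omega) hx) (mem_strands (by omega)))
    (mul_mem (mem_strands (by omega)) (strands_mono (by omega) hy))
  rwa [show x * f i * f (i + 1) * (f i * y) = x * (f i * f (i + 1) * f i) * y by
    simp only [mul_assoc], hf.braid_up i (by omega)] at h

theorem bridge_mono {k m : ℕ} (hkm : k ≤ m) (hm : m ≤ N) : bridge f k ≤ bridge f m := by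
  induction m, hkm using Nat.le_induction with
  | base => exact le_rfl
  | succ m _ ih => exact (ih (by omega)).trans (hf.bridge_mono_succ hm)

/-- Modulo scalars, `y` is a combination of products `x * f (n - 1) * y'` whose outer factors
commute with `f n`, so the braid relation collapses the sandwich; the scalar part is handled by the
square relation. The decomposition is taken as a hypothesis because its own induction uses this
lemma one level lower. -/
theorem sandwich_of {n : ℕ} (hn : n + 2 ≤ N)
    (h : ∀ b ∈ strands f (n + 1), ∃ c : ℂ, b - c • (1 : A) ∈ bridge f (n + 1))
    {y : A} (hy : y ∈ strands f (n + 1)) : ∃ y' ∈ strands f n, f n * y * f n = y' * f n := by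
  obtain ⟨c, hc⟩ := h y hy
  suffices H : ∀ j ∈ bridge f (n + 1), ∃ y' ∈ strands f n, f n * j * f n = y' * f n by
    obtain ⟨y', hy', e⟩ := H _ hc
    refine ⟨y' + algebraMap ℂ A (c * -d), add_mem hy' (Subalgebra.algebraMap_mem _ _), ?_⟩
    rw [add_mul, ← e, ← Algebra.smul_def, mul_smul, ← hf.sq n hn]
    simp [mul_sub, sub_mul]
  intro j hj
  rcases n with _ | n
  · have : bridge f 1 = ⊥ := by
      rw [bridge, Submodule.span_eq_bot]
      rintro x ⟨i, _, _, hi, _⟩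
      omega
    rw [zero_add, this, Submodule.mem_bot] at hj
    exact ⟨0, zero_mem _, by simp [hj]⟩
  · refine bridge_induction (p := fun j => ∃ y' ∈ strands f (n + 1),
      f (n + 1) * j * f (n + 1) = y' * f (n + 1)) ?_ ?_ ?_ ?_ hj
    · exact ⟨0, zero_mem _, by simp⟩
    · rintro x y ⟨x', hx', ex⟩ ⟨y', hy', ey⟩
      exact ⟨x' + y', add_mem hx' hy', by rw [mul_add, add_mul, add_mul, ex, ey]⟩
    · rintro c x ⟨x', hx', ex⟩
      exact ⟨c • x', Subalgebra.smul_mem _ hx' c, by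
        rw [mul_smul_comm, smul_mul_assoc, ex, smul_mul_assoc]⟩
    · intro x hx y hy
      refine ⟨x * y, mul_mem hx hy, ?_⟩
      have hx' := hf.commute_of_mem hn hx
      have hy' := hf.commute_of_mem hn hy
      calc f (n + 1) * (x * f n * y) * f (n + 1)
          = (f (n + 1) * x) * f n * (y * f (n + 1)) := by simp only [mul_assoc]
        _ = x * (f (n + 1) * f n * f (n + 1)) * y := by rw [← hx', hy']; simp only [mul_assoc]
        _ = x * y * f (n + 1) := by rw [hf.braid_down n hn, mul_assoc, ← hy', mul_assoc]

theorem mem_bridge_generator {i n : ℕ} (hi : i ≤ n) (hn : n + 2 ≤ N) : f i ∈ bridge f (n + 2) := by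
  refine hf.bridge_mono (k := i + 2) (by omega) hn ?_
  simpa using mem_bridge (f := f) (n := i) (one_mem _) (one_mem _)

/-- Modulo the span of the products through the last generator every element is a scalar. -/
theorem exists_sub_smul_mem_bridge {k : ℕ} (hk : k ≤ N) :
    ∀ b ∈ strands f k, ∃ c : ℂ, b - c • (1 : A) ∈ bridge f k := by
  induction k with
  | zero =>
    intro b hb
    obtain ⟨c, rfl⟩ := exists_eq_smul_of_le_one zero_le_one hb
    exact ⟨c, by simp⟩
  | succ k ih =>
    rcases k with _ | n
    · intro b hb
      obtain ⟨c, rfl⟩ := exists_eq_smul_of_le_one le_rfl hb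
      exact ⟨c, by simp⟩
    -- The bridge is a left ideal: earlier generators are absorbed into the left factor, and a
    -- second `f n` is removed by the sandwich lemma.
    have left : ∀ b ∈ strands f (n + 2), ∀ j ∈ bridge f (n + 2), b * j ∈ bridge f (n + 2) := by
      intro b hb
      refine Algebra.adjoin_induction
        (p := fun b _ => ∀ j ∈ bridge f (n + 2), b * j ∈ bridge f (n + 2)) ?_ ?_ ?_ ?_ hb
      · rintro _ ⟨i, hi : i + 2 ≤ n + 2, rfl⟩ j hj
        refine bridge_induction (p := fun j => f i * j ∈ bridge f (n + 2)) ?_ ?_ ?_ ?_ hj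
        · simp
        · intro x y hx hy
          rw [mul_add]
          exact add_mem hx hy
        · intro c x hx
          rw [mul_smul_comm]
          exact Submodule.smul_mem _ c hx
        · intro x hx y hy
          rcases Nat.lt_or_ge i n with h | h
          · rw [← mul_assoc, ← mul_assoc]
            exact mem_bridge (mul_mem (mem_strands (by omega)) hx) hy
          · obtain rfl : i = n := by omega
            obtain ⟨x', hx', e⟩ := hf.sandwich_of hk (ih (by omega)) hx
            rw [← mul_assoc, ← mul_assoc, e]
            exact mem_bridge (strands_mono (by omega) hx') hy
      · intro c j hj
        rw [← Algebra.smul_def]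
        exact Submodule.smul_mem _ c hj
      · intro x y _ _ hx hy j hj
        rw [add_mul]
        exact add_mem (hx j hj) (hy j hj)
      · intro x y _ _ hx hy j hj
        rw [mul_assoc]
        exact hx _ (hy j hj)
    intro b hb
    refine Algebra.adjoin_induction
      (p := fun b _ => ∃ c : ℂ, b - c • (1 : A) ∈ bridge f (n + 2)) ?_ ?_ ?_ ?_ hb
    · rintro _ ⟨i, hi : i + 2 ≤ n + 2, rfl⟩
      exact ⟨0, by simpa using hf.mem_bridge_generator (by omega) hk⟩
    · exact fun c => ⟨c, by simp [Algebra.algebraMap_eq_smul_one]⟩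
    · rintro x y _ _ ⟨c, hc⟩ ⟨c', hc'⟩
      refine ⟨c + c', ?_⟩
      rw [add_smul, add_sub_add_comm]
      exact add_mem hc hc'
    · rintro x y hx _ ⟨c, hc⟩ ⟨c', hc'⟩
      refine ⟨c * c', ?_⟩
      have e : x * y - (c * c') • (1 : A) = x * (y - c' • 1) + c' • (x - c • 1) := by
        simp only [mul_sub, mul_smul_comm, mul_one, smul_sub, smul_smul, mul_comm c]
        abel
      rw [e]
      exact add_mem (left x hx _ hc') (Submodule.smul_mem _ _ hc)

theorem sandwich {n : ℕ} (hn : n + 2 ≤ N) {y : A} (hy : y ∈ strands f (n + 1)) :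
    ∃ y' ∈ strands f n, f n * y * f n = y' * f n :=
  hf.sandwich_of hn (hf.exists_sub_smul_mem_bridge (by omega)) hy

theorem bridge_mul_mul {n : ℕ} (hn : n + 2 ≤ N) {j z : A} (hj : j ∈ bridge f (n + 2))
    (hz : z ∈ strands f (n + 1)) : ∃ x ∈ strands f (n + 1), j * z * f n = x * f n := by
  refine bridge_induction (p := fun j => ∃ x ∈ strands f (n + 1), j * z * f n = x * f n)
    ?_ ?_ ?_ ?_ hj
  · exact ⟨0, zero_mem _, by simp⟩
  · rintro x y ⟨x', hx', ex⟩ ⟨y', hy', ey⟩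
    exact ⟨x' + y', add_mem hx' hy', by rw [add_mul, add_mul, add_mul, ex, ey]⟩
  · rintro c x ⟨x', hx', ex⟩
    exact ⟨c • x', Subalgebra.smul_mem _ hx' c, by
      rw [smul_mul_assoc, smul_mul_assoc, ex, smul_mul_assoc]⟩
  · intro x hx y hy
    obtain ⟨y', hy', e⟩ := hf.sandwich hn (mul_mem hy hz)
    refine ⟨x * y', mul_mem hx (strands_mono (by omega) hy'), ?_⟩
    calc x * f n * y * z * f n = x * (f n * (y * z) * f n) := by simp only [mul_assoc]
      _ = x * y' * f n := by rw [e, mul_assoc]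

omit hf in
/-- Wenzl's recursion, with the auxiliary properties that drive it. -/
theorem wenzl_aux (hf : IsTLFamily d N f) {w : ℕ → ℂ} (w0 : w 0 = 1) (w1 : w 1 = d)
    (w2 : ∀ a, w (a + 2) = d * w (a + 1) - w a) (n : ℕ) (hn : n + 1 ≤ N)
    (hw : ∀ a ≤ n, w a ≠ 0) :
    ∃ E ∈ strands f (n + 1), ∃ E' ∈ strands f n, E - 1 ∈ bridge f (n + 1) ∧ E * E = E ∧
      (∀ i, i + 2 ≤ n + 1 → f i * E = 0) ∧ (∀ i, i + 2 ≤ n + 1 → E * f i = 0) ∧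
      E' * E = E ∧ E * E' = E ∧
      (n + 2 ≤ N → f n * E * f n = (-(w (n + 1) / w n)) • (E' * f n)) := by
  induction n with
  | zero =>
    refine ⟨1, one_mem _, 1, one_mem _, by simp, by simp, by omega, by omega, by simp, by simp,
      fun h => ?_⟩
    simp [w0, w1, hf.sq 0 h]
  | succ n ih =>
    obtain ⟨E, hE, E', hE', hE1, hEE, hl, hr, hE'E, hEE', hs⟩ :=
      ih (by omega) (fun a ha => hw a (by omega))
    have hs := hs hn
    have hwn := hw n (by omega)
    have hwn1 := hw (n + 1) le_rfl
    -- The coefficient is forced by `f n * (E + c • (E * f n * E)) = 0`. Its sign is positive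
    -- because the loop parameter is `-d`.
    set c := w n / w (n + 1) with hc
    have hcs : c * -(w (n + 1) / w n) = -1 := by
      rw [hc]
      field_simp
    have hE'c := hf.commute_of_mem hn hE'
    have hfE : f n * (E + c • (E * f n * E)) = 0 := by
      have : f n * (E + c • (E * f n * E)) = f n * E + c • (f n * E * f n * E) := by
        simp only [mul_add, mul_smul_comm, mul_assoc]
      rw [this, hs, smul_mul_assoc, smul_smul, hcs, hE'c, mul_assoc, hE'E]
      simp
    have hEf : (E + c • (E * f n * E)) * f n = 0 := by
      have : (E + c • (E * f n * E)) * f n = E * f n + c • (E * (f n * E * f n)) := by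
        simp only [add_mul, smul_mul_assoc, mul_assoc]
      rw [this, hs, mul_smul_comm, smul_smul, hcs, ← mul_assoc, hEE']
      simp
    have hFE : (E + c • (E * f n * E)) * E = E + c • (E * f n * E) := by
      simp only [add_mul, smul_mul_assoc, mul_assoc, hEE]
    have hEF : E * (E + c • (E * f n * E)) = E + c • (E * f n * E) := by
      simp only [mul_add, mul_smul_comm, ← mul_assoc, hEE]
    refine ⟨E + c • (E * f n * E), ?_, E, hE, ?_, ?_, ?_, ?_, hEF, hFE, ?_⟩
    · have hE2 := strands_mono (f := f) (show n + 1 ≤ n + 1 + 1 by omega) hE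
      exact add_mem hE2
        (Subalgebra.smul_mem _ (mul_mem (mul_mem hE2 (mem_strands le_rfl)) hE2) c)
    · rw [add_sub_right_comm]
      exact add_mem (hf.bridge_mono_succ (by omega) hE1)
        (Submodule.smul_mem _ _ (mem_bridge hE hE))
    · rw [mul_add (E + _), hFE, mul_smul_comm, ← mul_assoc, ← mul_assoc, hFE, hEf]
      simp
    · intro i hi
      rcases Nat.lt_or_ge i n with h | h
      · simp only [mul_add, mul_smul_comm, ← mul_assoc, hl i (by omega)]
        simp
      · obtain rfl : i = n := by omega
        exact hfE
    · intro i hi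
      rcases Nat.lt_or_ge i n with h | h
      · simp only [add_mul, smul_mul_assoc, mul_assoc, hr i (by omega)]
        simp
      · obtain rfl : i = n := by omega
        exact hEf
    -- The new coefficient is `-d + w n / w (n + 1)`, which the recursion for `w` turns into `-(w (n
    -- + 2) / w (n + 1))`. This uses only `w (n + 1) ≠ 0`, so `w (n + 2)` may vanish.
    · intro h
      have hEc := hf.commute_of_mem h hE
      have e1 : f (n + 1) * (E + c • (E * f n * E)) * f (n + 1)
          = (f (n + 1) * E) * f (n + 1) + c • ((f (n + 1) * E) * f n * (E * f (n + 1))) := by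
        simp only [mul_add, add_mul, mul_smul_comm, smul_mul_assoc, mul_assoc]
      have e2 : E * f (n + 1) * f n * (f (n + 1) * E) = E * f (n + 1) := by
        calc E * f (n + 1) * f n * (f (n + 1) * E)
            = E * (f (n + 1) * f n * f (n + 1)) * E := by simp only [mul_assoc]
          _ = E * f (n + 1) := by rw [hf.braid_down n h, mul_assoc, ← hEc, ← mul_assoc, hEE]
      rw [← hEc] at e2
      rw [e1, ← hEc, mul_assoc E, hf.sq _ h, e2, mul_smul_comm, ← add_smul]
      congr 1
      rw [w2, hc]
      field_simp
      ring

/-- The Jones-Wenzl idempotent exists as long as the quantum integers do not vanish. -/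
theorem exists_jonesWenzl {w : ℕ → ℂ} (w0 : w 0 = 1) (w1 : w 1 = d)
    (w2 : ∀ a, w (a + 2) = d * w (a + 1) - w a) {k : ℕ} (hk : k ≤ N)
    (hw : ∀ a < k, w a ≠ 0) :
    ∃ E ∈ strands f k, E - 1 ∈ bridge f k ∧ E * E = E ∧
      (∀ i, i + 2 ≤ k → f i * E = 0) ∧ (∀ i, i + 2 ≤ k → E * f i = 0) := by
  rcases k with _ | n
  · exact ⟨1, one_mem _, by simp, by simp, by omega, by omega⟩
  · obtain ⟨E, hE, _, _, h1, h2, h3, h4, _⟩ :=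
      wenzl_aux hf w0 w1 w2 n hk (fun a ha => hw a (by omega))
    exact ⟨E, hE, h1, h2, h3, h4⟩

end IsTLFamily

end Generic

/-! ### The path representation -/

section Paths

/-- The neighbours of `a` in the path graph on the vertices `0, …, L - 1`. -/
def nbr (L a : ℕ) : Finset ℕ := (Finset.range L).filter (fun b => a + 1 = b ∨ b + 1 = a)

theorem mem_nbr {L a b : ℕ} : b ∈ nbr L a ↔ b < L ∧ (a + 1 = b ∨ b + 1 = a) := by
  simp [nbr]

theorem mem_nbr_symm {L a b : ℕ} (ha : a < L) (h : b ∈ nbr L a) : a ∈ nbr L b := by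
  rw [mem_nbr] at *
  omega

/-- Infinite walks from `0` on the path graph. -/
structure IsPath (L : ℕ) (x : ℕ → ℕ) : Prop where
  zero : x 0 = 0
  adj : ∀ i, x (i + 1) ∈ nbr L (x i)

theorem IsPath.lt {L : ℕ} {x : ℕ → ℕ} (hx : IsPath L x) (i : ℕ) : x i < L := by
  rcases i with _ | i
  · have := (mem_nbr.1 (hx.adj 0)).1
    have := hx.zero
    omega
  · exact (mem_nbr.1 (hx.adj i)).1

/-- The type of infinite walks from `0` on the path graph. -/
abbrev LatticePath (L : ℕ) : Type := {x : ℕ → ℕ // IsPath L x}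

namespace LatticePath

variable {L : ℕ}

open Classical in
/-- Replace the vertex visited at time `i + 1`, if the result is a walk. -/
noncomputable def modify (x : LatticePath L) (i b : ℕ) : LatticePath L :=
  if h : IsPath L (Function.update x.1 (i + 1) b) then ⟨_, h⟩ else x

theorem modify_val {x : LatticePath L} {i b : ℕ} (hx : x.1 i = x.1 (i + 2))
    (hb : b ∈ nbr L (x.1 i)) : (x.modify i b).1 = Function.update x.1 (i + 1) b := by
  have h : IsPath L (Function.update x.1 (i + 1) b) := by
    refine ⟨by simpa using x.2.zero, fun j => ?_⟩
    rcases eq_or_ne j i with rfl | h1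
    · simpa using hb
    · rcases eq_or_ne j (i + 1) with rfl | h2
      · simpa [← hx] using mem_nbr_symm (x.2.lt i) hb
      · rw [Function.update_of_ne (show j + 1 ≠ i + 1 by omega), Function.update_of_ne h2]
        exact x.2.adj j
  rw [modify, dif_pos h]

theorem modify_same {x : LatticePath L} {i b : ℕ} (hx : x.1 i = x.1 (i + 2))
    (hb : b ∈ nbr L (x.1 i)) : (x.modify i b).1 (i + 1) = b := by
  rw [modify_val hx hb, Function.update_self]

theorem modify_of_ne {x : LatticePath L} {i b j : ℕ} (hx : x.1 i = x.1 (i + 2))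
    (hb : b ∈ nbr L (x.1 i)) (hj : j ≠ i + 1) : (x.modify i b).1 j = x.1 j := by
  rw [modify_val hx hb, Function.update_of_ne hj]

open Classical in
/-- Replace the first `k` steps of a walk, if the result is a walk. -/
noncomputable def graft (k : ℕ) (T : ℕ → ℕ) (x : LatticePath L) : LatticePath L :=
  if h : IsPath L (fun i => if i ≤ k then T i else x.1 i) then ⟨_, h⟩ else x

end LatticePath

open LatticePath

/-- The operator by which the `i`-th generator acts on functions of walks. -/
noncomputable def pathOp (L : ℕ) (w : ℕ → ℂ) (i : ℕ) : Module.End ℂ (LatticePath L → ℂ) where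
  toFun φ x := if x.1 i = x.1 (i + 2) then
    -∑ b ∈ nbr L (x.1 i), w b / w (x.1 i) * φ (x.modify i b) else 0
  map_add' φ ψ := by
    ext x
    simp only [Pi.add_apply]
    split_ifs
    · simp only [mul_add, Finset.sum_add_distrib, neg_add]
    · simp
  map_smul' c φ := by
    ext x
    simp only [Pi.smul_apply, smul_eq_mul, RingHom.id_apply]
    split_ifs
    · simp only [mul_neg, Finset.mul_sum]
      exact congrArg _ (Finset.sum_congr rfl fun b _ => by ring)
    · simp

variable {L : ℕ} {w : ℕ → ℂ} {d : ℂ}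

theorem pathOp_of_eq {i : ℕ} {x : LatticePath L} (h : x.1 i = x.1 (i + 2))
    (φ : LatticePath L → ℂ) : pathOp L w i φ x =
      -∑ b ∈ nbr L (x.1 i), w b / w (x.1 i) * φ (x.modify i b) := if_pos h

theorem pathOp_of_ne {i : ℕ} {x : LatticePath L} (h : x.1 i ≠ x.1 (i + 2))
    (φ : LatticePath L → ℂ) : pathOp L w i φ x = 0 := if_neg h

/-- The operator averages over the vertex at time `i + 1`, so its output does not depend on that
vertex. -/
theorem pathOp_modify {i b : ℕ} {x : LatticePath L} (h : x.1 i = x.1 (i + 2))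
    (hb : b ∈ nbr L (x.1 i)) (φ : LatticePath L → ℂ) :
    pathOp L w i φ (x.modify i b) = pathOp L w i φ x := by
  have h1 : (x.modify i b).1 i = x.1 i := modify_of_ne h hb (by omega)
  have h2 : (x.modify i b).1 (i + 2) = x.1 (i + 2) := modify_of_ne h hb (by omega)
  rw [pathOp_of_eq h, pathOp_of_eq (by rw [h1, h2, h]), h1]
  refine congrArg _ (Finset.sum_congr rfl fun c hc => ?_)
  congr 2
  apply Subtype.ext
  rw [modify_val h hc, modify_val (by rw [h1, h2, h]) (by rwa [h1]), modify_val h hb,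
    Function.update_idem]

/-- Weights on the vertices of the path graph forming a nowhere vanishing eigenvector of the
adjacency matrix. -/
structure IsEigenweight (d : ℂ) (L : ℕ) (w : ℕ → ℂ) : Prop where
  ne_zero : ∀ a < L, w a ≠ 0
  sum_nbr : ∀ a < L, ∑ b ∈ nbr L a, w b = d * w a

/-- The square relation is the eigenvector equation. In each braid relation the two inner conditions
leave a single term of the double sum, and its weight ratios are mutually inverse. Operators at
distance at least two change separate vertices without affecting each other's conditions. -/
theorem isTLFamily_pathOp (hw : IsEigenweight d L w) (N : ℕ) :
    IsTLFamily d N (pathOp L w) where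
  sq i _ := by
    refine LinearMap.ext fun φ => funext fun x => ?_
    rw [Module.End.mul_apply, LinearMap.smul_apply, Pi.smul_apply]
    by_cases h : x.1 i = x.1 (i + 2)
    · rw [pathOp_of_eq h]
      rw [Finset.sum_congr rfl fun b hb => by rw [pathOp_modify h hb], ← Finset.sum_mul,
        ← Finset.sum_div, hw.sum_nbr _ (x.2.lt i), mul_div_cancel_right₀ _ (hw.ne_zero _ (x.2.lt i)),
        smul_eq_mul, neg_mul]
    · simp [pathOp_of_ne h]
  braid_up i _ := by
    refine LinearMap.ext fun φ => funext fun x => ?_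
    rw [Module.End.mul_apply, Module.End.mul_apply]
    by_cases h : x.1 i = x.1 (i + 2)
    · have ha := hw.ne_zero _ (x.2.lt i)
      have hmem : x.1 (i + 3) ∈ nbr L (x.1 i) := h ▸ x.2.adj (i + 2)
      have hb := hw.ne_zero _ (x.2.lt (i + 3))
      rw [pathOp_of_eq h, Finset.sum_eq_single_of_mem _ hmem]
      · have e1 : (x.modify i (x.1 (i + 3))).1 (i + 1) = x.1 (i + 3) := modify_same h hmem
        have e2 : (x.modify i (x.1 (i + 3))).1 (i + 3) = x.1 (i + 3) :=
          modify_of_ne h hmem (by omega)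
        have e3 : (x.modify i (x.1 (i + 3))).1 i = x.1 i := modify_of_ne h hmem (by omega)
        have e4 : (x.modify i (x.1 (i + 3))).1 (i + 2) = x.1 i :=
          (modify_of_ne h hmem (by omega)).trans h.symm
        have h' : (x.modify i (x.1 (i + 3))).1 (i + 1) = (x.modify i (x.1 (i + 3))).1 (i + 1 + 2) :=
          e1.trans e2.symm
        have hmem' := mem_nbr_symm (x.2.lt i) hmem
        rw [pathOp_of_eq h', e1, Finset.sum_eq_single_of_mem _ hmem']
        · rw [show (x.modify i (x.1 (i + 3))).modify (i + 1) (x.1 i) = x.modify i (x.1 (i + 3)) by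
            apply Subtype.ext
            rw [modify_val h' (by rwa [e1]), ← e4, Function.update_eq_self], pathOp_modify h hmem]
          field_simp
        · intro c hc hne
          rw [pathOp_of_ne, mul_zero]
          rw [modify_of_ne h' (by rwa [e1]) (by omega), modify_same h' (by rwa [e1]), e3]
          exact hne.symm
      · intro b hb hne
        rw [pathOp_of_ne, mul_zero]
        rw [modify_same h hb, modify_of_ne h hb (by omega)]
        exact hne
    · rw [pathOp_of_ne h, pathOp_of_ne h]
  braid_down i _ := by
    refine LinearMap.ext fun φ => funext fun x => ?_
    rw [Module.End.mul_apply, Module.End.mul_apply]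
    by_cases h : x.1 (i + 1) = x.1 (i + 1 + 2)
    · have ha := hw.ne_zero _ (x.2.lt (i + 1))
      have hmem : x.1 i ∈ nbr L (x.1 (i + 1)) := mem_nbr_symm (x.2.lt i) (x.2.adj i)
      have hb := hw.ne_zero _ (x.2.lt i)
      rw [pathOp_of_eq h, Finset.sum_eq_single_of_mem _ hmem]
      · set y := x.modify (i + 1) (x.1 i) with hy
        have e1 : y.1 (i + 2) = x.1 i := modify_same h hmem
        have e2 : y.1 i = x.1 i := modify_of_ne h hmem (by omega)
        have e3 : y.1 (i + 1 + 2) = x.1 (i + 1) := (modify_of_ne h hmem (by omega)).trans h.symm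
        have e4 : y.1 (i + 1) = x.1 (i + 1) := modify_of_ne h hmem (by omega)
        have h' : y.1 i = y.1 (i + 2) := e2.trans e1.symm
        have hmem' := mem_nbr_symm (x.2.lt (i + 1)) hmem
        rw [pathOp_of_eq h', e2, Finset.sum_eq_single_of_mem _ hmem']
        · rw [show y.modify i (x.1 (i + 1)) = y by
            apply Subtype.ext
            rw [modify_val h' (by rwa [e2]), ← e4, Function.update_eq_self], hy,
            pathOp_modify h hmem]
          field_simp
        · intro c hc hne
          rw [pathOp_of_ne, mul_zero]
          rw [modify_same h' (by rwa [e2]), modify_of_ne h' (by rwa [e2]) (by omega), e3]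
          exact hne
      · intro b hb hne
        rw [pathOp_of_ne, mul_zero]
        rw [modify_same h hb, modify_of_ne h hb (by omega)]
        exact hne.symm
    · rw [pathOp_of_ne h, pathOp_of_ne h]
  comm i j hij _ := by
    refine LinearMap.ext fun φ => funext fun x => ?_
    rw [Module.End.mul_apply, Module.End.mul_apply]
    by_cases h : x.1 i = x.1 (i + 2)
    · by_cases h' : x.1 j = x.1 (j + 2)
      · have key : ∀ b ∈ nbr L (x.1 i), ∀ c ∈ nbr L (x.1 j),
            (x.modify i b).modify j c = (x.modify j c).modify i b := by
          intro b hb c hc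
          apply Subtype.ext
          rw [modify_val, modify_val h hb, modify_val, modify_val h' hc, Function.update_comm]
          · omega
          · rw [modify_of_ne h' hc (by omega), modify_of_ne h' hc (by omega), h]
          · rwa [modify_of_ne h' hc (by omega)]
          · rw [modify_of_ne h hb (by omega), modify_of_ne h hb (by omega), h']
          · rwa [modify_of_ne h hb (by omega)]
        have e1 : ∀ b ∈ nbr L (x.1 i), w b / w (x.1 i) * pathOp L w j φ (x.modify i b) =
            -∑ c ∈ nbr L (x.1 j), w b / w (x.1 i) * (w c / w (x.1 j) *
              φ ((x.modify i b).modify j c)) := by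
          intro b hb
          have hj : (x.modify i b).1 j = x.1 j := modify_of_ne h hb (by omega)
          rw [pathOp_of_eq, hj, mul_neg, Finset.mul_sum]
          rw [hj, modify_of_ne h hb (by omega), h']
        have e2 : ∀ c ∈ nbr L (x.1 j), w c / w (x.1 j) * pathOp L w i φ (x.modify j c) =
            -∑ b ∈ nbr L (x.1 i), w c / w (x.1 j) * (w b / w (x.1 i) *
              φ ((x.modify j c).modify i b)) := by
          intro c hc
          have hi : (x.modify j c).1 i = x.1 i := modify_of_ne h' hc (by omega)
          rw [pathOp_of_eq, hi, mul_neg, Finset.mul_sum]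
          rw [hi, modify_of_ne h' hc (by omega), h]
        rw [pathOp_of_eq h, pathOp_of_eq h', Finset.sum_congr rfl e1, Finset.sum_congr rfl e2,
          Finset.sum_neg_distrib, Finset.sum_neg_distrib, Finset.sum_comm]
        refine congrArg _ (congrArg _ (Finset.sum_congr rfl fun c hc =>
          Finset.sum_congr rfl fun b hb => ?_))
        rw [key b hb c hc]
        ring
      · rw [pathOp_of_ne h', pathOp_of_eq h, Finset.sum_eq_zero, neg_zero]
        intro b hb
        rw [pathOp_of_ne, mul_zero]
        rwa [modify_of_ne h hb (by omega), modify_of_ne h hb (by omega)]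
    · rw [pathOp_of_ne h]
      by_cases h' : x.1 j = x.1 (j + 2)
      · rw [pathOp_of_eq h', Finset.sum_eq_zero, neg_zero]
        intro b hb
        rw [pathOp_of_ne, mul_zero]
        rwa [modify_of_ne h' hb (by omega), modify_of_ne h' hb (by omega)]
      · rw [pathOp_of_ne h']

end Paths

/-! ### Finite walks and matrix units -/

section Walks

open LatticePath

variable {L : ℕ} {w : ℕ → ℂ} {d : ℂ}

/-- The first `k` steps of `S` form a walk from `0`. -/
structure IsWalk (L k : ℕ) (S : ℕ → ℕ) : Prop where
  zero : S 0 = 0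
  adj : ∀ i < k, S (i + 1) ∈ nbr L (S i)

namespace IsWalk

variable {k : ℕ} {S : ℕ → ℕ}

theorem lt (hL : 2 ≤ L) (hS : IsWalk L k S) {i : ℕ} (hi : i ≤ k) : S i < L := by
  rcases i with _ | i
  · rw [hS.zero]
    omega
  · exact (mem_nbr.1 (hS.adj i (by omega))).1

theorem mono {m : ℕ} (hS : IsWalk L k S) (h : m ≤ k) : IsWalk L m S :=
  ⟨hS.zero, fun i hi => hS.adj i (by omega)⟩

theorem congr {T : ℕ → ℕ} (hS : IsWalk L k S) (h : ∀ i ≤ k, S i = T i) : IsWalk L k T :=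
  ⟨by rw [← h 0 (by omega), hS.zero], fun i hi => by
    rw [← h (i + 1) (by omega), ← h i (by omega)]
    exact hS.adj i hi⟩

theorem update (hS : IsWalk L k S) {a : ℕ} (ha : a ∈ nbr L (S k)) :
    IsWalk L (k + 1) (Function.update S (k + 1) a) := by
  refine ⟨by simpa using hS.zero, fun i hi => ?_⟩
  rcases eq_or_ne i k with rfl | h
  · simpa using ha
  · rw [Function.update_of_ne (show i + 1 ≠ k + 1 by omega),
      Function.update_of_ne (show i ≠ k + 1 by omega)]
    exact hS.adj i (by omega)

theorem exists_extend (hL : 2 ≤ L) (hS : IsWalk L k S) :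
    ∃ x : LatticePath L, ∀ i ≤ k, x.1 i = S i := by
  -- The extension descends to `0` and then alternates between `0` and `1`, which stays in the graph
  -- because `2 ≤ L`.
  set nb : ℕ → ℕ := fun a => if a = 0 then 1 else a - 1 with hnb
  have hnb' : ∀ a < L, nb a ∈ nbr L a := by
    intro a ha
    simp only [hnb, mem_nbr]
    split_ifs <;> omega
  have hit : ∀ m, nb^[m] (S k) < L := by
    intro m
    induction m with
    | zero => exact hS.lt hL le_rfl
    | succ m ih =>
      rw [Function.iterate_succ_apply']
      exact (mem_nbr.1 (hnb' _ ih)).1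
  refine ⟨⟨fun i => if i ≤ k then S i else nb^[i - k] (S k), ⟨?_, fun i => ?_⟩⟩, fun i hi => ?_⟩
  · simpa using hS.zero
  · rcases lt_trichotomy i k with h | rfl | h
    · simpa [h.le, Nat.succ_le_of_lt h] using hS.adj i h
    · simpa using hnb' _ (hS.lt hL le_rfl)
    · simp only [show ¬ i + 1 ≤ k by omega, show ¬ i ≤ k by omega, if_false,
        show i + 1 - k = (i - k) + 1 by omega, Function.iterate_succ_apply']
      exact hnb' _ (hit _)
  · simp [hi]

theorem bounds (hS : IsWalk L k S) {i : ℕ} (hi : i ≤ k) :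
    S i ≤ i ∧ (S i + i) % 2 = 0 ∧ S k ≤ S i + (k - i) ∧ S i ≤ S k + (k - i) := by
  constructor
  · induction i with
    | zero => rw [hS.zero]
    | succ i ih =>
      have := (mem_nbr.1 (hS.adj i (by omega))).2
      have := ih (by omega)
      omega
  constructor
  · induction i with
    | zero => rw [hS.zero]
    | succ i ih =>
      have := (mem_nbr.1 (hS.adj i (by omega))).2
      have := ih (by omega)
      omega
  · obtain ⟨m, rfl⟩ := Nat.exists_eq_add_of_le hi
    clear hi
    induction m with
    | zero => simp
    | succ m ih =>
      have := ih (hS.mono (by omega))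
      have := (mem_nbr.1 (hS.adj (i + m) (by omega))).2
      rw [← add_assoc] at *
      omega

end IsWalk

theorem LatticePath.isWalk (x : LatticePath L) (k : ℕ) : IsWalk L k x.1 :=
  ⟨x.2.zero, fun i _ => x.2.adj i⟩

theorem graft_val {k : ℕ} {T : ℕ → ℕ} {x : LatticePath L} (hT : IsWalk L k T)
    (h : T k = x.1 k) : (graft k T x).1 = fun i => if i ≤ k then T i else x.1 i := by
  have H : IsPath L (fun i => if i ≤ k then T i else x.1 i) := by
    refine ⟨by simpa using hT.zero, fun i => ?_⟩
    rcases lt_trichotomy i k with hi | rfl | hi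
    · simpa [hi.le, Nat.succ_le_of_lt hi] using hT.adj i hi
    · simpa [h] using x.2.adj i
    · simpa [show ¬ i + 1 ≤ k by omega, show ¬ i ≤ k by omega] using x.2.adj i
  rw [graft, dif_pos H]

theorem graft_of_le {k : ℕ} {T : ℕ → ℕ} {x : LatticePath L} (hT : IsWalk L k T)
    (h : T k = x.1 k) {i : ℕ} (hi : i ≤ k) : (graft k T x).1 i = T i := by
  rw [graft_val hT h]
  exact if_pos hi

theorem graft_of_ge {k : ℕ} {T : ℕ → ℕ} {x : LatticePath L} (hT : IsWalk L k T)
    (h : T k = x.1 k) {i : ℕ} (hi : k ≤ i) : (graft k T x).1 i = x.1 i := by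
  rw [graft_val hT h]
  rcases hi.eq_or_lt with rfl | hi
  · simpa using h
  · exact if_neg (by omega)

open Classical in
/-- The operator replacing the initial segment `S` of a walk by `T`. -/
noncomputable def matUnit (L k : ℕ) (S T : ℕ → ℕ) : Module.End ℂ (LatticePath L → ℂ) where
  toFun φ x := if ∀ i ≤ k, x.1 i = S i then φ (graft k T x) else 0
  map_add' φ ψ := by
    ext x
    simp only [Pi.add_apply]
    split_ifs <;> simp
  map_smul' c φ := by
    ext x
    simp only [Pi.smul_apply, smul_eq_mul, RingHom.id_apply]
    split_ifs <;> simp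

theorem matUnit_of_eq {k : ℕ} {S T : ℕ → ℕ} {x : LatticePath L} (h : ∀ i ≤ k, x.1 i = S i)
    (φ : LatticePath L → ℂ) : matUnit L k S T φ x = φ (graft k T x) := if_pos h

theorem matUnit_of_ne {k : ℕ} {S T : ℕ → ℕ} {x : LatticePath L} (h : ¬ ∀ i ≤ k, x.1 i = S i)
    (φ : LatticePath L → ℂ) : matUnit L k S T φ x = 0 := if_neg h

theorem matUnit_congr {k : ℕ} {S S' T T' : ℕ → ℕ} (hS : ∀ i ≤ k, S i = S' i)
    (hT : ∀ i ≤ k, T i = T' i) : matUnit L k S T = matUnit L k S' T' := by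
  refine LinearMap.ext fun φ => funext fun x => ?_
  have e : graft k T x = graft k T' x := by
    have : (fun i => if i ≤ k then T i else x.1 i) = fun i => if i ≤ k then T' i else x.1 i := by
      funext i
      split_ifs with h
      exacts [hT i h, rfl]
    unfold graft
    split_ifs with h1 h2 h2
    · exact Subtype.ext this
    · exact absurd (this ▸ h1) h2
    · exact absurd (this ▸ h2) h1
    · rfl
  by_cases h : ∀ i ≤ k, x.1 i = S i
  · rw [matUnit_of_eq h, matUnit_of_eq (fun i hi => (h i hi).trans (hS i hi)), e]
  · rw [matUnit_of_ne h, matUnit_of_ne]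
    exact fun h' => h fun i hi => (h' i hi).trans (hS i hi).symm

open Classical in
-- Operators act by substitution, so a product is read from left to right on the walk: `S` becomes
-- `T`, the vertex at time `n + 1` is changed, and the result must begin with `S'`. Only the summand
-- `b = S' (n + 1)` survives, and the return condition fixes the vertex at time `n + 2` to be `T n`.
theorem matUnit_mul_pathOp_mul {n : ℕ} {S T S' T' : ℕ → ℕ} (hT : IsWalk L (n + 1) T)
    (hS' : IsWalk L (n + 1) S') (hT' : IsWalk L (n + 1) T') (h : S (n + 1) = T (n + 1))
    (h' : S' (n + 1) = T' (n + 1)) (hL : 2 ≤ L) :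
    matUnit L (n + 1) S T * pathOp L w n * matUnit L (n + 1) S' T' =
      if ∀ i ≤ n, T i = S' i then
        (-(w (S' (n + 1)) / w (T n))) • matUnit L (n + 2) (Function.update S (n + 2) (T n))
          (Function.update T' (n + 2) (T n))
      else 0 := by
  refine LinearMap.ext fun φ => funext fun x => ?_
  rw [Module.End.mul_apply, Module.End.mul_apply]
  have hR : ∀ P : Prop, [Decidable P] → ∀ G : Module.End ℂ (LatticePath L → ℂ),
      (if P then G else 0) φ x = if P then G φ x else 0 := by
    intro P _ G
    split_ifs <;> simp
  rw [hR]
  by_cases hx : ∀ i ≤ n + 1, x.1 i = S i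
  swap
  · rw [matUnit_of_ne hx, LinearMap.smul_apply, Pi.smul_apply, matUnit_of_ne, smul_zero, ite_self]
    refine fun hx' => hx fun i hi => ?_
    rw [hx' i (by omega), Function.update_of_ne (by omega)]
  have hTx : T (n + 1) = x.1 (n + 1) := by rw [hx _ le_rfl, h]
  rw [matUnit_of_eq hx]
  have y0 : ∀ i ≤ n + 1, (graft (n + 1) T x).1 i = T i := fun i hi => graft_of_le hT hTx hi
  have y1 : ∀ i, n + 1 ≤ i → (graft (n + 1) T x).1 i = x.1 i := fun i hi => graft_of_ge hT hTx hi
  set y := graft (n + 1) T x with hy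
  have hyn : y.1 n = T n := y0 n (by omega)
  have hyn2 : y.1 (n + 2) = x.1 (n + 2) := y1 _ (by omega)
  by_cases ha : x.1 (n + 2) = T n
  swap
  · rw [pathOp_of_ne (by rw [hyn, hyn2]; exact Ne.symm ha), LinearMap.smul_apply, Pi.smul_apply,
      matUnit_of_ne, smul_zero, ite_self]
    intro hx'
    have := hx' (n + 2) le_rfl
    rw [Function.update_self] at this
    exact ha this
  have hyy : y.1 n = y.1 (n + 2) := by rw [hyn, hyn2, ha]
  have hx2 : ∀ i ≤ n + 2, x.1 i = Function.update S (n + 2) (T n) i := by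
    intro i hi
    rcases eq_or_ne i (n + 2) with rfl | hne
    · rw [Function.update_self, ha]
    · rw [Function.update_of_ne hne, hx i (by omega)]
  rw [pathOp_of_eq hyy, hyn, LinearMap.smul_apply, Pi.smul_apply, matUnit_of_eq hx2]
  by_cases hTS : ∀ i ≤ n, T i = S' i
  · have hmem : S' (n + 1) ∈ nbr L (T n) := hTS n le_rfl ▸ hS'.adj n (by omega)
    have hmem' : S' (n + 1) ∈ nbr L (y.1 n) := by rwa [hyn]
    rw [if_pos hTS, Finset.sum_eq_single_of_mem _ hmem, matUnit_of_eq, smul_eq_mul, neg_mul]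
    · congr 3
      apply Subtype.ext
      have e1 : T' (n + 1) = (y.modify n (S' (n + 1))).1 (n + 1) := by
        rw [modify_same hyy hmem', h']
      have hW : IsWalk L (n + 2) (Function.update T' (n + 2) (T n)) :=
        hT'.update (h' ▸ mem_nbr_symm (hT.lt hL (by omega)) hmem)
      funext i
      rcases Nat.lt_or_ge (n + 1) i with hi | hi
      · rw [graft_of_ge hT' e1 hi.le, modify_of_ne hyy hmem' (by omega), y1 i hi.le,
          graft_of_ge hW (by rw [Function.update_self, ha]) hi]
      · rw [graft_of_le hT' e1 hi, graft_of_le hW (by rw [Function.update_self, ha]) (by omega),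
          Function.update_of_ne (by omega)]
    · intro i hi
      rcases eq_or_ne i (n + 1) with rfl | hne
      · exact modify_same hyy hmem'
      · rw [modify_of_ne hyy hmem' hne, y0 i hi, hTS i (by omega)]
    · intro b hb hne
      rw [matUnit_of_ne, mul_zero]
      intro H
      rw [← H _ le_rfl, modify_same hyy (by rwa [hyn])] at hne
      exact hne rfl
  · rw [if_neg hTS, Finset.sum_eq_zero, neg_zero]
    intro b hb
    rw [matUnit_of_ne, mul_zero]
    intro H
    refine hTS fun i hi => ?_
    rw [← H i (by omega), modify_of_ne hyy (by rwa [hyn]) (by omega), y0 i (by omega)]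

/-! ### The finite set of walks and independence of the matrix units -/

open Classical in
/-- The walks of length `k` from `0`, extended by zero. -/
noncomputable def walks (L : ℕ) : ℕ → Finset (ℕ → ℕ)
  | 0 => {0}
  | k + 1 => (walks L k).biUnion fun S => (nbr L (S k)).image fun b => Function.update S (k + 1) b

theorem mem_walks {k : ℕ} {S : ℕ → ℕ} :
    S ∈ walks L k ↔ IsWalk L k S ∧ ∀ i, k < i → S i = 0 := by
  induction k generalizing S with
  | zero =>
    simp only [walks, Finset.mem_singleton]
    constructor
    · rintro rfl
      exact ⟨⟨rfl, by omega⟩, fun _ _ => rfl⟩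
    · rintro ⟨h, h'⟩
      funext i
      rcases Nat.eq_zero_or_pos i with rfl | hi
      exacts [h.zero, h' i hi]
  | succ k ih =>
    simp only [walks, Finset.mem_biUnion, Finset.mem_image, ih]
    constructor
    · rintro ⟨S, ⟨hS, h0⟩, b, hb, rfl⟩
      refine ⟨hS.update hb, fun i hi => ?_⟩
      rw [Function.update_of_ne (by omega), h0 i (by omega)]
    · rintro ⟨hS, h0⟩
      refine ⟨Function.update S (k + 1) 0, ⟨?_, fun i hi => ?_⟩, S (k + 1), ?_, ?_⟩
      · exact (hS.mono (by omega)).congr fun i hi => by rw [Function.update_of_ne (by omega)]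
      · rcases eq_or_ne i (k + 1) with rfl | h
        · simp
        · rw [Function.update_of_ne h, h0 i (by omega)]
      · rw [Function.update_of_ne (by omega)]
        exact hS.adj k (by omega)
      · simp

theorem eq_of_mem_walks {k : ℕ} {S T : ℕ → ℕ} (hS : S ∈ walks L k) (hT : T ∈ walks L k)
    (h : ∀ i ≤ k, S i = T i) : S = T := by
  funext i
  rcases Nat.lt_or_ge k i with hi | hi
  · rw [(mem_walks.1 hS).2 i hi, (mem_walks.1 hT).2 i hi]
  · exact h i hi

/-- The walk of length `k` with the same first `k` steps as `S`. -/
def truncate (k : ℕ) (S : ℕ → ℕ) : ℕ → ℕ := fun i => if i ≤ k then S i else 0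

theorem truncate_of_le {k i : ℕ} (S : ℕ → ℕ) (h : i ≤ k) : truncate k S i = S i := if_pos h

theorem truncate_mem_walks {k : ℕ} {S : ℕ → ℕ} (hS : IsWalk L k S) : truncate k S ∈ walks L k :=
  mem_walks.2 ⟨hS.congr fun _ hi => (truncate_of_le S hi).symm, fun _ hi => if_neg (by omega)⟩

/-- The pairs of walks of length `k` with a common endpoint. -/
noncomputable def walkPairs (L k : ℕ) : Finset ((ℕ → ℕ) × (ℕ → ℕ)) :=
  (walks L k ×ˢ walks L k).filter fun p => p.1 k = p.2 k

theorem mem_walkPairs {k : ℕ} {S T : ℕ → ℕ} :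
    (S, T) ∈ walkPairs L k ↔ S ∈ walks L k ∧ T ∈ walks L k ∧ S k = T k := by
  simp [walkPairs, and_assoc]

/-- The family of matrix units indexed by pairs of walks of length `k`. -/
noncomputable def matUnits (L k : ℕ) (p : walkPairs L k) : Module.End ℂ (LatticePath L → ℂ) :=
  matUnit L k p.1.1 p.1.2

theorem matUnit_mem_span {k : ℕ} {S T : ℕ → ℕ} (hS : IsWalk L k S) (hT : IsWalk L k T)
    (h : S k = T k) : matUnit L k S T ∈ Submodule.span ℂ (Set.range (matUnits L k)) := by
  refine Submodule.subset_span ⟨⟨(truncate k S, truncate k T), mem_walkPairs.2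
    ⟨truncate_mem_walks hS, truncate_mem_walks hT, ?_⟩⟩, ?_⟩
  · rw [truncate_of_le _ le_rfl, truncate_of_le _ le_rfl, h]
  · exact matUnit_congr (fun i hi => truncate_of_le _ hi) (fun i hi => truncate_of_le _ hi)

theorem sum_matUnit (k : ℕ) : ∑ S ∈ walks L k, matUnit L k S S = 1 := by
  refine LinearMap.ext fun φ => funext fun x => ?_
  rw [LinearMap.sum_apply, Finset.sum_apply,
    Finset.sum_eq_single_of_mem _ (truncate_mem_walks (x.isWalk k))]
  · have h : ∀ i ≤ k, x.1 i = truncate k x.1 i := fun i hi => (truncate_of_le _ hi).symm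
    rw [matUnit_of_eq h, Module.End.one_apply]
    congr 1
    apply Subtype.ext
    have hW := (mem_walks.1 (truncate_mem_walks (x.isWalk k))).1
    funext i
    rcases Nat.lt_or_ge k i with hi | hi
    · rw [graft_of_ge hW (h k le_rfl).symm hi.le]
    · rw [graft_of_le hW (h k le_rfl).symm hi, h i hi]
  · intro S hS hne
    rw [matUnit_of_ne]
    intro H
    exact hne (eq_of_mem_walks hS (truncate_mem_walks (x.isWalk k))
      fun i hi => by rw [← H i hi, truncate_of_le _ hi])

open Classical in
/-- The indicator function of the walks with initial segment `T`. -/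
noncomputable def cylinder (L k : ℕ) (T : ℕ → ℕ) : LatticePath L → ℂ :=
  fun x => if ∀ i ≤ k, x.1 i = T i then 1 else 0

open Classical in
theorem matUnit_cylinder {k : ℕ} {S T S' T' : ℕ → ℕ} (h : (S, T) ∈ walkPairs L k)
    (h' : (S', T') ∈ walkPairs L k) {x : LatticePath L} (hx : ∀ i ≤ k, x.1 i = S i) :
    matUnit L k S' T' (cylinder L k T) x = if (S', T') = (S, T) then 1 else 0 := by
  rw [mem_walkPairs] at h h'
  by_cases hS : S' = S
  · subst hS
    rw [matUnit_of_eq hx]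
    have hW := (mem_walks.1 h'.2.1).1
    have e : T' k = x.1 k := by rw [hx k le_rfl, h'.2.2]
    by_cases hT : T' = T
    · subst hT
      rw [if_pos rfl]
      exact if_pos fun i hi => graft_of_le hW e hi
    · rw [if_neg (by simpa using hT)]
      refine if_neg fun H => hT (eq_of_mem_walks h'.2.1 h.2.1 fun i hi => ?_)
      rw [← H i hi, graft_of_le hW e hi]
  · rw [if_neg (by simp [hS]), matUnit_of_ne]
    exact fun H => hS (eq_of_mem_walks h'.1 h.1 fun i hi => by rw [← H i hi, hx i hi])

/-- Coefficient extraction: testing on a cylinder function fixes the second walk, and evaluating at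
`x` fixes the first. -/
theorem sum_matUnits_cylinder {k : ℕ} (g : walkPairs L k → ℂ) (p : walkPairs L k)
    {x : LatticePath L} (hx : ∀ i ≤ k, x.1 i = p.1.1 i) :
    (∑ p', g p' • matUnits L k p') (cylinder L k p.1.2) x = g p := by
  rw [LinearMap.sum_apply, Finset.sum_apply, Finset.sum_eq_single_of_mem p (Finset.mem_univ _)]
  · rw [LinearMap.smul_apply, Pi.smul_apply, matUnits, matUnit_cylinder p.2 p.2 hx]
    simp
  · intro p' _ hne
    rw [LinearMap.smul_apply, Pi.smul_apply, matUnits, matUnit_cylinder p.2 p'.2 hx, if_neg,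
      smul_zero]
    exact fun H => hne (Subtype.ext H)

theorem linearIndependent_matUnits (hL : 2 ≤ L) (k : ℕ) :
    LinearIndependent ℂ (matUnits L k) := by
  rw [Fintype.linearIndependent_iff]
  intro g hg p
  obtain ⟨x, hx⟩ := (mem_walks.1 (mem_walkPairs.1 p.2).1).1.exists_extend hL
  rw [← sum_matUnits_cylinder g p hx, hg]
  rfl

end Walks

/-! ### The algebra generated by the path operators -/

section PathAlgebra

open LatticePath

variable {L : ℕ} {w : ℕ → ℂ} {d : ℂ}

theorem mul_mul_mem_span {A : Type*} [Ring A] [Algebra ℂ A] {s : Set A} {V : Submodule ℂ A}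
    {u x y : A} (h : ∀ a ∈ s, ∀ b ∈ s, a * u * b ∈ V) (hx : x ∈ Submodule.span ℂ s)
    (hy : y ∈ Submodule.span ℂ s) : x * u * y ∈ V := by
  have h1 : ∀ a ∈ s, ∀ y ∈ Submodule.span ℂ s, a * u * y ∈ V := by
    intro a ha y hy
    have : Submodule.span ℂ s ≤ V.comap (LinearMap.mulLeft ℂ (a * u)) :=
      Submodule.span_le.2 fun b hb => h a ha b hb
    exact this hy
  have : Submodule.span ℂ s ≤ V.comap (LinearMap.mulRight ℂ (u * y)) :=
    Submodule.span_le.2 fun a ha => by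
      simpa [mul_assoc] using h1 a ha y hy
  simpa [mul_assoc] using this hx

theorem one_mem_span_matUnits (k : ℕ) :
    (1 : Module.End ℂ (LatticePath L → ℂ)) ∈ Submodule.span ℂ (Set.range (matUnits L k)) := by
  rw [← sum_matUnit]
  exact sum_mem fun S hS => matUnit_mem_span (mem_walks.1 hS).1 (mem_walks.1 hS).1 rfl

theorem mem_span_matUnits (hL : 2 ≤ L) (hw : IsEigenweight d L w) (k : ℕ)
    {b : Module.End ℂ (LatticePath L → ℂ)} (hb : b ∈ strands (pathOp L w) k) :
    b ∈ Submodule.span ℂ (Set.range (matUnits L k)) := by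
  induction k generalizing b with
  | zero =>
    obtain ⟨c, rfl⟩ := exists_eq_smul_of_le_one zero_le_one hb
    exact Submodule.smul_mem _ c (one_mem_span_matUnits 0)
  | succ k ih =>
    rcases k with _ | n
    · obtain ⟨c, rfl⟩ := exists_eq_smul_of_le_one le_rfl hb
      exact Submodule.smul_mem _ c (one_mem_span_matUnits 1)
    obtain ⟨c, hc⟩ := (isTLFamily_pathOp hw (n + 2)).exists_sub_smul_mem_bridge le_rfl b hb
    rw [← sub_add_cancel b (c • 1)]
    refine add_mem ?_ (Submodule.smul_mem _ c (one_mem_span_matUnits _))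
    refine bridge_induction (p := (· ∈ Submodule.span ℂ (Set.range (matUnits L (n + 2)))))
      (zero_mem _) (fun x y => add_mem) (fun c x => Submodule.smul_mem _ c) ?_ hc
    intro x hx y hy
    refine mul_mul_mem_span ?_ (ih hx) (ih hy)
    rintro _ ⟨⟨⟨S, T⟩, h⟩, rfl⟩ _ ⟨⟨⟨S', T'⟩, h'⟩, rfl⟩
    rw [mem_walkPairs, mem_walks, mem_walks] at h h'
    classical
    change matUnit L (n + 1) S T * _ * matUnit L (n + 1) S' T' ∈ _
    rw [matUnit_mul_pathOp_mul h.2.1.1 h'.1.1 h'.2.1.1 h.2.2 h'.2.2 hL]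
    split_ifs with H
    · refine Submodule.smul_mem _ _ (matUnit_mem_span (h.1.1.update ?_) (h'.2.1.1.update ?_) ?_)
      · rw [h.2.2]
        exact mem_nbr_symm (h.2.1.1.lt hL (by omega)) (h.2.1.1.adj n (by omega))
      · rw [← h'.2.2, H n le_rfl]
        exact mem_nbr_symm (h'.1.1.lt hL (by omega)) (h'.1.1.adj n (by omega))
      · simp
    · exact zero_mem _

/-! ### Generation of the matrix units by the path operators -/

theorem isWalk_staircase {k : ℕ} (hk : k < L) : IsWalk L k (fun i => i) :=
  ⟨rfl, fun i hi => mem_nbr.2 ⟨by omega, by omega⟩⟩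

theorem exists_walk (hL : 2 ≤ L) {a j : ℕ} (ha : a < L) :
    ∃ R, IsWalk L (a + 2 * j) R ∧ R (a + 2 * j) = a := by
  induction j with
  | zero => exact ⟨_, isWalk_staircase ha, rfl⟩
  | succ j ih =>
    obtain ⟨R, hR, e⟩ := ih
    have hb : ∃ b, b ∈ nbr L a := ⟨if a = 0 then 1 else a - 1, by
      rw [mem_nbr]
      split_ifs <;> omega⟩
    obtain ⟨b, hb⟩ := hb
    refine ⟨_, (hR.update (e.symm ▸ hb)).update (a := a) ?_, ?_⟩
    · rw [Function.update_self]
      exact mem_nbr_symm ha hb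
    · exact Function.update_self ..

/-- The endpoint has the parity of `n + 2` and is at most `n + 2`. It is thus either reachable in
`n` steps, or equal to `n + 2`, in which case every step goes up. -/
theorem exists_walk_or_staircase (hL : 2 ≤ L) {n : ℕ} {S : ℕ → ℕ} (hS : IsWalk L (n + 2) S) :
    (∃ R, IsWalk L n R ∧ R n = S (n + 2)) ∨ (n + 2 < L ∧ ∀ i ≤ n + 2, S i = i) := by
  obtain ⟨h1, h2, -⟩ := hS.bounds le_rfl
  have h3 := hS.lt hL le_rfl
  rcases Nat.lt_or_ge n (S (n + 2)) with h | h
  · right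
    refine ⟨by omega, fun i hi => ?_⟩
    have := hS.bounds hi
    omega
  · left
    obtain ⟨R, hR, e⟩ := exists_walk hL (j := (n - S (n + 2)) / 2) h3
    rw [show S (n + 2) + 2 * ((n - S (n + 2)) / 2) = n by omega] at hR e
    exact ⟨R, hR, e⟩

/-- A walk `R` reaching the common endpoint two steps earlier can be inserted in the middle:
extended by `U (n + 1)` on one side and by `V (n + 1)` on the other, it makes the product formula
yield a nonzero multiple of the desired unit. -/
theorem matUnit_mem_bridge_of (hL : 2 ≤ L) (hw : IsEigenweight d L w) {n : ℕ}
    (ih : ∀ S T, IsWalk L (n + 1) S → IsWalk L (n + 1) T → S (n + 1) = T (n + 1) →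
      matUnit L (n + 1) S T ∈ strands (pathOp L w) (n + 1))
    {R U V : ℕ → ℕ} (hR : IsWalk L n R) (hU : IsWalk L (n + 2) U) (hV : IsWalk L (n + 2) V)
    (hRU : R n = U (n + 2)) (hUV : U (n + 2) = V (n + 2)) :
    matUnit L (n + 2) U V ∈ bridge (pathOp L w) (n + 2) := by
  classical
  have hs : U (n + 1) ∈ nbr L (R n) := by
    rw [hRU]
    exact mem_nbr_symm (hU.lt hL (by omega)) (hU.adj (n + 1) (by omega))
  have ht : V (n + 1) ∈ nbr L (R n) := by
    rw [hRU, hUV]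
    exact mem_nbr_symm (hV.lt hL (by omega)) (hV.adj (n + 1) (by omega))
  have hU' := hU.mono (show n + 1 ≤ n + 2 by omega)
  have hV' := hV.mono (show n + 1 ≤ n + 2 by omega)
  have hmul := matUnit_mul_pathOp_mul (w := w) (S := U) (hR.update hs) (hR.update ht) hV' (by simp)
    (by simp) hL
  have hRn : Function.update R (n + 1) (U (n + 1)) n = R n := Function.update_of_ne (by omega) _ _
  rw [if_pos (fun i hi => by
    rw [Function.update_of_ne (by omega), Function.update_of_ne (by omega)]), hRn,
    Function.update_self, hRU, Function.update_eq_self, hUV, Function.update_eq_self] at hmul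
  have hc : -(w (V (n + 1)) / w (V (n + 2))) ≠ 0 :=
    neg_ne_zero.2 (div_ne_zero (hw.ne_zero _ (hV.lt hL (by omega)))
      (hw.ne_zero _ (hV.lt hL (by omega))))
  rw [← Submodule.smul_mem_iff _ hc, ← hmul]
  exact mem_bridge (ih _ _ hU' (hR.update hs) (by simp)) (ih _ _ (hR.update ht) hV' (by simp))

theorem matUnit_mem_strands (hL : 2 ≤ L) (hw : IsEigenweight d L w) {k : ℕ} {S T : ℕ → ℕ}
    (hS : IsWalk L k S) (hT : IsWalk L k T) (h : S k = T k) :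
    matUnit L k S T ∈ strands (pathOp L w) k := by
  induction k generalizing S T with
  | zero =>
    have e : ∀ R, IsWalk L 0 R → ∀ i ≤ 0, R i = 0 := fun R hR i hi => by
      rw [Nat.le_zero.1 hi, hR.zero]
    rw [matUnit_congr (S' := 0) (T' := 0) (e S hS) (e T hT),
      show matUnit L 0 0 0 = 1 by simpa [walks] using sum_matUnit (L := L) 0]
    exact one_mem _
  | succ k ih =>
    rcases k with _ | n
    · have e : ∀ R, IsWalk L 1 R → ∀ i ≤ 1, R i = i := fun R hR i hi => by
        have := hR.bounds hi
        have := hR.bounds le_rfl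
        have := (mem_nbr.1 (hR.adj 0 (by omega))).2
        have := hR.zero
        rcases i with _ | i
        · exact hR.zero
        · obtain rfl : i = 0 := by omega
          omega
      suffices H : matUnit L (0 + 1) S T = 1 by
        rw [H]
        exact one_mem _
      rw [← sum_matUnit (0 + 1), Finset.sum_eq_single_of_mem _ (truncate_mem_walks hS)]
      · refine matUnit_congr (fun i hi => (truncate_of_le _ hi).symm) fun i hi => ?_
        rw [truncate_of_le _ hi, e S hS i hi, e T hT i hi]
      · intro R hR hne
        refine absurd (eq_of_mem_walks hR (truncate_mem_walks hS) fun i hi => ?_) hne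
        rw [truncate_of_le _ hi, e R (mem_walks.1 hR).1 i hi, e S hS i hi]
    · have ih' := fun S T hS hT h => ih (S := S) (T := T) hS hT h
      rcases exists_walk_or_staircase hL hS with ⟨R, hR, hRS⟩ | ⟨hn, hS'⟩
      · exact bridge_le_strands _ (matUnit_mem_bridge_of hL hw ih' hR hS hT hRS h)
      · have hT' : ∀ i ≤ n + 2, T i = i := fun i hi => by
          have h : S (n + 2) = T (n + 2) := h
          have := IsWalk.bounds (k := n + 2) hT hi
          have := hS' (n + 2) le_rfl
          omega
        have hU := isWalk_staircase hn
        have hUm := truncate_mem_walks hU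
        have hsum := sum_matUnit (L := L) (n + 2)
        classical
        -- The staircase unit does not factor through the last generator; it is recovered as `1`
        -- minus all other diagonal units.
        rw [← Finset.add_sum_erase _ _ hUm] at hsum
        rw [matUnit_congr (S' := truncate (n + 2) fun i => i) (T' := truncate (n + 2) fun i => i)
          (fun i hi => by rw [hS' i hi, truncate_of_le _ hi])
          (fun i hi => by rw [hT' i hi, truncate_of_le _ hi]), eq_sub_of_add_eq hsum]
        refine sub_mem (one_mem _) (sum_mem fun R hR => ?_)
        rw [Finset.mem_erase] at hR
        have hRw := (mem_walks.1 hR.2).1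
        rcases exists_walk_or_staircase hL hRw with ⟨R', hR', e⟩ | ⟨_, hR'⟩
        · exact bridge_le_strands _ (matUnit_mem_bridge_of hL hw ih' hR' hRw hRw e rfl)
        · exact absurd (eq_of_mem_walks hR.2 hUm fun i hi => by
            rw [hR' i hi, truncate_of_le _ hi]) hR.1

/-- The algebra generated by the path operators is spanned by the matrix units. -/
theorem toSubmodule_strands_pathOp (hL : 2 ≤ L) (hw : IsEigenweight d L w) (k : ℕ) :
    Subalgebra.toSubmodule (strands (pathOp L w) k) =
      Submodule.span ℂ (Set.range (matUnits L k)) := by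
  refine le_antisymm (fun b hb => mem_span_matUnits hL hw k hb) (Submodule.span_le.2 ?_)
  rintro _ ⟨⟨⟨S, T⟩, h⟩, rfl⟩
  rw [mem_walkPairs, mem_walks, mem_walks] at h
  exact matUnit_mem_strands hL hw h.1.1 h.2.1.1 h.2.2

theorem one_mem_bridge_pathOp (hL : 2 ≤ L) (hw : IsEigenweight d L w) :
    1 ∈ bridge (pathOp L w) L := by
  obtain ⟨n, rfl⟩ := Nat.exists_eq_add_of_le' hL
  rw [← sum_matUnit (n + 2)]
  refine sum_mem fun S hS => ?_
  have hSw := (mem_walks.1 hS).1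
  rcases exists_walk_or_staircase hL hSw with ⟨R, hR, e⟩ | ⟨h, _⟩
  · exact matUnit_mem_bridge_of hL hw (fun S T hS hT h => matUnit_mem_strands hL hw hS hT h)
      hR hSw hSw e rfl
  -- A staircase of length `L` would end at the vertex `L`, outside the graph.
  · omega

/-- `X` alters only the first `n + 1` steps and keeps the vertex at time `n + 1`, so it evaluates
its argument only at walks passing through `T (n + 1)` and then `T n`. At these walks the path
operator multiplies the cylinder function by the stated constant. -/
theorem pathOp_cylinder_apply {n : ℕ} {X : Module.End ℂ (LatticePath L → ℂ)}
    (hX : X ∈ Submodule.span ℂ (Set.range (matUnits L (n + 1)))) {T : ℕ → ℕ}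
    (hT : IsWalk L (n + 1) T) {x : LatticePath L} (h1 : x.1 (n + 1) = T (n + 1))
    (h2 : x.1 (n + 2) = T n) :
    X (pathOp L w n (cylinder L (n + 1) T)) x =
      -(w (T (n + 1)) / w (T n)) * X (cylinder L (n + 1) T) x := by
  set c := -(w (T (n + 1)) / w (T n)) with hc
  let ev : Module.End ℂ (LatticePath L → ℂ) →ₗ[ℂ] ℂ :=
    { toFun := fun X => X (pathOp L w n (cylinder L (n + 1) T) - c • cylinder L (n + 1) T) x
      map_add' := fun _ _ => rfl
      map_smul' := fun _ _ => rfl }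
  suffices H : Submodule.span ℂ (Set.range (matUnits L (n + 1))) ≤ LinearMap.ker ev by
    have : X (pathOp L w n (cylinder L (n + 1) T) - c • cylinder L (n + 1) T) x = 0 := H hX
    rw [map_sub, map_smul, Pi.sub_apply, Pi.smul_apply, smul_eq_mul] at this
    exact sub_eq_zero.1 this
  refine Submodule.span_le.2 ?_
  rintro _ ⟨⟨⟨S, S'⟩, h⟩, rfl⟩
  rw [mem_walkPairs, mem_walks, mem_walks] at h
  change matUnit L (n + 1) S S' _ x = 0
  by_cases hx : ∀ i ≤ n + 1, x.1 i = S i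
  swap
  · exact matUnit_of_ne hx _
  rw [matUnit_of_eq hx]
  have e : S' (n + 1) = x.1 (n + 1) := by rw [hx _ le_rfl, h.2.2]
  have y0 : ∀ i ≤ n + 1, (graft (n + 1) S' x).1 i = S' i := fun i hi => graft_of_le h.2.1.1 e hi
  have y1 : (graft (n + 1) S' x).1 (n + 2) = T n :=
    (graft_of_ge h.2.1.1 e (by omega)).trans h2
  set y := graft (n + 1) S' x
  rw [Pi.sub_apply, Pi.smul_apply, smul_eq_mul, sub_eq_zero]
  by_cases hyT : ∀ i ≤ n, y.1 i = T i
  · have hyy : y.1 n = y.1 (n + 2) := by rw [hyT n le_rfl, y1]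
    have hmem : T (n + 1) ∈ nbr L (y.1 n) := by
      rw [hyT n le_rfl]
      exact hT.adj n (by omega)
    have hyc : cylinder L (n + 1) T y = 1 := if_pos fun i hi => by
      rcases eq_or_ne i (n + 1) with rfl | hne
      · rw [y0 _ le_rfl, e, h1]
      · exact hyT i (by omega)
    rw [hyc, pathOp_of_eq hyy, Finset.sum_eq_single_of_mem _ hmem, hyT n le_rfl]
    · have : cylinder L (n + 1) T (y.modify n (T (n + 1))) = 1 := if_pos fun i hi => by
        rcases eq_or_ne i (n + 1) with rfl | hne
        · exact modify_same hyy hmem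
        · rw [modify_of_ne hyy hmem hne, hyT i (by omega)]
      rw [this, hc]
      ring
    · intro b hb hne
      rw [cylinder, if_neg, mul_zero]
      intro H
      rw [← H _ le_rfl, modify_same hyy hb] at hne
      exact hne rfl
  · rw [show cylinder L (n + 1) T y = 0 from if_neg fun H => hyT fun i hi => H i (by omega),
      mul_zero]
    by_cases hyy : y.1 n = y.1 (n + 2)
    · rw [pathOp_of_eq hyy, Finset.sum_eq_zero, neg_zero]
      intro b hb
      rw [cylinder, if_neg, mul_zero]
      intro H
      refine hyT fun i hi => ?_
      rw [← H i (by omega), modify_of_ne hyy hb (by omega)]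
    · exact pathOp_of_ne hyy _

/-- Right multiplication by a path operator is injective on the operators generated by the
preceding ones. -/
theorem eq_zero_of_mul_pathOp_eq_zero (hL : 2 ≤ L) (hw : IsEigenweight d L w) {n : ℕ}
    {X : Module.End ℂ (LatticePath L → ℂ)} (hX : X ∈ strands (pathOp L w) (n + 1))
    (h : X * pathOp L w n = 0) : X = 0 := by
  have hXs := mem_span_matUnits hL hw _ hX
  obtain ⟨g, rfl⟩ := (Submodule.mem_span_range_iff_exists_fun ℂ).1 hXs
  refine Finset.sum_eq_zero fun p _ => ?_
  suffices hg : g p = 0 by rw [hg, zero_smul]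
  obtain ⟨⟨S, T⟩, hp⟩ := p
  have hST := mem_walkPairs.1 hp
  have hS := (mem_walks.1 hST.1).1
  have hT := (mem_walks.1 hST.2.1).1
  have hmem : T n ∈ nbr L (S (n + 1)) := by
    rw [hST.2.2]
    exact mem_nbr_symm (hT.lt hL (by omega)) (hT.adj n (by omega))
  -- The walk follows `S` and then steps to `T n`, so that the cylinder identity applies and
  -- isolates the coefficient of `(S, T)`.
  obtain ⟨x, hx⟩ := (hS.update hmem).exists_extend hL
  have hxS : ∀ i ≤ n + 1, x.1 i = S i := fun i hi => by
    rw [hx i (by omega), Function.update_of_ne (by omega)]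
  have key := pathOp_cylinder_apply (w := w) hXs hT (x := x) (by rw [hxS _ le_rfl, hST.2.2])
    (by rw [hx _ le_rfl, Function.update_self])
  rw [← Module.End.mul_apply, h, sum_matUnits_cylinder g ⟨(S, T), hp⟩ hxS] at key
  have hc : -(w (T (n + 1)) / w (T n)) ≠ 0 :=
    neg_ne_zero.2 (div_ne_zero (hw.ne_zero _ (hT.lt hL (by omega)))
      (hw.ne_zero _ (hT.lt hL (by omega))))
  exact (mul_eq_zero.1 key.symm).resolve_left hc

/-- A strictly rising walk never has `x i = x (i + 2)`, so every generator vanishes there.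
Evaluation at such a walk detects the scalar part of an element. -/
theorem exists_apply_staircase {k : ℕ} {x : LatticePath L} (hx : ∀ i ≤ k, x.1 i = i)
    {b : Module.End ℂ (LatticePath L → ℂ)} (hb : b ∈ strands (pathOp L w) k) :
    ∃ c : ℂ, ∀ φ, b φ x = c * φ x := by
  refine Algebra.adjoin_induction (p := fun b _ => ∃ c : ℂ, ∀ φ, b φ x = c * φ x) ?_ ?_ ?_ ?_ hb
  · rintro _ ⟨i, hi : i + 2 ≤ k, rfl⟩
    refine ⟨0, fun φ => ?_⟩
    rw [pathOp_of_ne, zero_mul]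
    rw [hx i (by omega), hx _ hi]
    omega
  · exact fun c => ⟨c, fun φ => rfl⟩
  · rintro a b _ _ ⟨c, hc⟩ ⟨c', hc'⟩
    exact ⟨c + c', fun φ => by rw [LinearMap.add_apply, Pi.add_apply, hc, hc', add_mul]⟩
  · rintro a b _ _ ⟨c, hc⟩ ⟨c', hc'⟩
    exact ⟨c * c', fun φ => by rw [Module.End.mul_apply, hc, hc', mul_assoc]⟩

theorem bridge_apply_staircase {n : ℕ} {x : LatticePath L} (hx : ∀ i ≤ n + 2, x.1 i = i)
    {b : Module.End ℂ (LatticePath L → ℂ)} (hb : b ∈ bridge (pathOp L w) (n + 2))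
    (φ : LatticePath L → ℂ) : b φ x = 0 := by
  refine bridge_induction (p := fun b => b φ x = 0) rfl ?_ ?_ ?_ hb
  · intro a b ha hb
    rw [LinearMap.add_apply, Pi.add_apply, ha, hb, add_zero]
  · intro c a ha
    rw [LinearMap.smul_apply, Pi.smul_apply, ha, smul_zero]
  · intro a ha b _
    obtain ⟨c, hc⟩ := exists_apply_staircase (fun i hi => hx i (by omega)) ha
    rw [Module.End.mul_apply, Module.End.mul_apply, hc, pathOp_of_ne, mul_zero]
    rw [hx n (by omega), hx _ le_rfl]
    omega

/-- A family whose Jones-Wenzl idempotent on `L` strings vanishes is determined by its image in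
the path representation. -/
theorem eq_zero_of_map_eq_zero {A : Type*} [Ring A] [Algebra ℂ A] {N : ℕ} {f : ℕ → A}
    (hf : IsTLFamily d N f) (hL : 2 ≤ L) (hw : IsEigenweight d L w) (w0 : w 0 = 1) (w1 : w 1 = d)
    (w2 : ∀ a, w (a + 2) = d * w (a + 1) - w a) (h1 : L ≤ N → 1 ∈ bridge f L)
    (ρ : A →ₐ[ℂ] Module.End ℂ (LatticePath L → ℂ)) (hρ : ∀ i, i + 2 ≤ N → ρ (f i) = pathOp L w i)
    {k : ℕ} (hk : k ≤ N) {b : A} (hb : b ∈ strands f k) (h0 : ρ b = 0) : b = 0 := by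
  have hne : Nontrivial (LatticePath L → ℂ) := by
    obtain ⟨x, -⟩ := (isWalk_staircase (L := L) (k := 0) (by omega)).exists_extend hL
    have : Nonempty (LatticePath L) := ⟨x⟩
    infer_instance
  have hsc : ∀ {k : ℕ} {b : A}, k ≤ 1 → b ∈ strands f k → ρ b = 0 → b = 0 := by
    intro k b hk hb h0
    obtain ⟨c, rfl⟩ := exists_eq_smul_of_le_one hk hb
    rw [map_smul, map_one, smul_eq_zero, or_iff_left one_ne_zero] at h0
    rw [h0, zero_smul]
  induction k generalizing b with
  | zero => exact hsc zero_le_one hb h0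
  | succ k ih =>
    rcases k with _ | n
    · exact hsc le_rfl hb h0
    -- Each `j * x * f n` has the form `X * f n` with `X` on one strand fewer. In the representation
    -- `f n` can be cancelled on the right, so the induction hypothesis gives `X = 0`.
    have hinj : ∀ {j : A}, j ∈ bridge f (n + 2) → ρ j = 0 → ∀ z ∈ bridge f (n + 2), j * z = 0 := by
      intro j hj hj0 z hz
      refine bridge_induction (p := fun z => j * z = 0) (mul_zero j) ?_ ?_ ?_ hz
      · intro x y hx hy
        rw [mul_add, hx, hy, add_zero]
      · intro c x hx
        rw [mul_smul_comm, hx, smul_zero]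
      · intro x hx y _
        obtain ⟨X, hX, e⟩ := hf.bridge_mul_mul hk hj hx
        have hX0 : X = 0 := by
          refine ih (by omega) hX (eq_zero_of_mul_pathOp_eq_zero hL hw (n := n)
            (map_mem_strands ρ (fun i hi => hρ i (by omega)) hX) ?_)
          rw [← hρ n hk, ← map_mul, ← e, map_mul, map_mul, hj0, zero_mul, zero_mul]
        rw [← mul_assoc, ← mul_assoc, e, hX0, zero_mul, zero_mul]
    obtain ⟨c, hc⟩ := hf.exists_sub_smul_mem_bridge hk b hb
    rcases Nat.lt_or_ge (n + 2) L with hn | hn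
    · have hc0 : c = 0 := by
        obtain ⟨x, hx⟩ := (isWalk_staircase hn).exists_extend hL
        have := bridge_apply_staircase hx
          (map_mem_bridge ρ (fun i hi => hρ i (by omega)) hc) (fun _ => 1)
        rw [map_sub, h0, map_smul, map_one, zero_sub] at this
        simpa using this
      rw [hc0, zero_smul, sub_zero] at hc
      -- Since `b` lies in the bridge, both `b * (E - 1)` and `b * E` vanish.
      obtain ⟨E, -, hE1, -, hE, -⟩ :=
        hf.exists_jonesWenzl w0 w1 w2 hk (fun a ha => hw.ne_zero a (by omega))
      have e := hinj hc h0 _ hE1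
      rwa [mul_sub, bridge_mul_eq_zero hE hc, mul_one, zero_sub, neg_eq_zero] at e
    · have h1' := hf.bridge_mono hn hk (h1 (hn.trans hk))
      have hb' : b ∈ bridge f (n + 2) := by
        rw [← sub_add_cancel b (c • 1)]
        exact add_mem hc (Submodule.smul_mem _ c h1')
      simpa using hinj hb' h0 1 h1'

end PathAlgebra

/-! ### Counting walks -/

section Counting

variable {L : ℕ}

/-- The number of walks of length `k` from `0` to `a`. -/
noncomputable def walkCount (L k a : ℕ) : ℕ := ((walks L k).filter fun S => S k = a).card

theorem walkCount_zero (a : ℕ) : walkCount L 0 a = if a = 0 then 1 else 0 := by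
  rw [walkCount, walks, Finset.filter_singleton]
  by_cases h : a = 0
  · simp [h]
  · simp [h, Ne.symm h]

theorem walkCount_of_ge (hL : 2 ≤ L) {k a : ℕ} (ha : L ≤ a) : walkCount L k a = 0 := by
  rw [walkCount, Finset.card_eq_zero, Finset.filter_eq_empty_iff]
  intro S hS h
  have := (mem_walks.1 hS).1.lt hL le_rfl
  omega

theorem walkCount_of_lt {k a : ℕ} (ha : k < a) : walkCount L k a = 0 := by
  rw [walkCount, Finset.card_eq_zero, Finset.filter_eq_empty_iff]
  intro S hS h
  have := (mem_walks.1 hS).1.bounds le_rfl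
  omega

theorem walkCount_succ (hL : 2 ≤ L) {k a : ℕ} (ha : a < L) :
    walkCount L (k + 1) a = ∑ b ∈ nbr L a, walkCount L k b := by
  rw [walkCount, Finset.card_eq_sum_card_fiberwise (f := fun S => S k) (t := nbr L a)]
  · refine Finset.sum_congr rfl fun b hb => ?_
    refine Finset.card_nbij' (fun S => Function.update S (k + 1) 0)
      (fun S => Function.update S (k + 1) a) ?_ ?_ ?_ ?_
    · intro S hS
      simp only [Finset.coe_filter, Finset.mem_filter, Set.mem_ofPred_eq, mem_walks] at hS ⊢
      refine ⟨⟨(hS.1.1.1.mono (by omega)).congr fun i hi => by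
        rw [Function.update_of_ne (by omega)], fun i hi => ?_⟩, ?_⟩
      · rcases eq_or_ne i (k + 1) with rfl | h
        · simp
        · rw [Function.update_of_ne h, hS.1.1.2 i (by omega)]
      · rw [Function.update_of_ne (by omega), hS.2]
    · intro S hS
      simp only [Finset.coe_filter, Finset.mem_filter, Set.mem_ofPred_eq, mem_walks] at hS ⊢
      refine ⟨⟨⟨hS.1.1.update ?_, fun i hi => ?_⟩, Function.update_self ..⟩, ?_⟩
      · rw [hS.2]
        exact mem_nbr_symm ha hb
      · rw [Function.update_of_ne (by omega), hS.1.2 i (by omega)]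
      · rw [Function.update_of_ne (by omega), hS.2]
    · intro S hS
      simp only [Finset.coe_filter, Finset.mem_filter, Set.mem_ofPred_eq, mem_walks] at hS
      simp [← hS.1.2]
    · intro S hS
      simp only [Finset.coe_filter, Set.mem_ofPred_eq, mem_walks] at hS
      simp [← hS.1.2 (k + 1) (by omega)]
  · intro S hS
    simp only [Finset.coe_filter, Set.mem_ofPred_eq, mem_walks] at hS
    rw [← hS.2]
    exact mem_nbr_symm (hS.1.1.lt hL (by omega)) (hS.1.1.adj k (by omega))

theorem sum_nbr_zero {M : Type*} [AddCommMonoid M] (hL : 2 ≤ L) (g : ℕ → M) :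
    ∑ b ∈ nbr L 0, g b = g 1 := by
  rw [show nbr L 0 = {1} by
    ext b
    rw [mem_nbr, Finset.mem_singleton]
    omega, Finset.sum_singleton]

theorem sum_nbr_succ {M : Type*} [AddCommMonoid M] {a : ℕ} (ha : a + 1 < L) (g : ℕ → M)
    (hg : g L = 0) : ∑ b ∈ nbr L (a + 1), g b = g a + g (a + 2) := by
  rcases Nat.lt_or_ge (a + 2) L with h | h
  · rw [show nbr L (a + 1) = {a, a + 2} by
      ext b
      rw [mem_nbr, Finset.mem_insert, Finset.mem_singleton]
      omega, Finset.sum_pair (by omega)]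
  · rw [show nbr L (a + 1) = {a} by
      ext b
      rw [mem_nbr, Finset.mem_singleton]
      omega, Finset.sum_singleton, show a + 2 = L by omega, hg, add_zero]

/-- Adjacency is symmetric, so a step can be moved from one walk to the other until the first has
length zero. -/
theorem sum_walkCount_mul (hL : 2 ≤ L) (m n : ℕ) :
    ∑ a ∈ Finset.range L, walkCount L m a * walkCount L n a = walkCount L (m + n) 0 := by
  induction m generalizing n with
  | zero =>
    rw [Finset.sum_eq_single_of_mem 0 (Finset.mem_range.2 (by omega)), walkCount_zero, if_pos rfl,
      one_mul, zero_add]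
    intro b _ hb
    rw [walkCount_zero, if_neg hb, zero_mul]
  | succ m ih =>
    rw [add_right_comm, add_assoc, ← ih (n + 1)]
    have e1 : ∀ a ∈ Finset.range L, walkCount L (m + 1) a * walkCount L n a =
        ∑ b ∈ nbr L a, walkCount L m b * walkCount L n a := fun a ha => by
      rw [walkCount_succ hL (Finset.mem_range.1 ha), Finset.sum_mul]
    have e2 : ∀ b ∈ Finset.range L, walkCount L m b * walkCount L (n + 1) b =
        ∑ a ∈ nbr L b, walkCount L m b * walkCount L n a := fun a ha => by
      rw [walkCount_succ hL (Finset.mem_range.1 ha), Finset.mul_sum]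
    rw [Finset.sum_congr rfl e1, Finset.sum_congr rfl e2]
    refine Finset.sum_comm' fun a b => ?_
    simp only [Finset.mem_range, mem_nbr]
    omega

theorem card_walkPairs (hL : 2 ≤ L) (k : ℕ) : (walkPairs L k).card = walkCount L (2 * k) 0 := by
  rw [two_mul, ← sum_walkCount_mul hL, Finset.card_eq_sum_card_fiberwise
    (f := fun p : (ℕ → ℕ) × (ℕ → ℕ) => p.1 k) (t := Finset.range L)]
  · refine Finset.sum_congr rfl fun a _ => ?_
    rw [walkCount, ← Finset.card_product]
    congr 1
    ext ⟨S, T⟩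
    simp only [Finset.mem_filter, mem_walkPairs, Finset.mem_product]
    constructor
    · rintro ⟨⟨h1, h2, h3⟩, h4⟩
      exact ⟨⟨h1, h4⟩, h2, h3 ▸ h4⟩
    · rintro ⟨⟨h1, h2⟩, h3, h4⟩
      exact ⟨⟨h1, h3, h2.trans h4.symm⟩, h2⟩
  · rintro ⟨S, T⟩ h
    simp only [Finset.mem_coe, mem_walkPairs] at h
    simpa using (mem_walks.1 h.1).1.lt hL le_rfl

/-! ### Generating functions of walks -/

/-- The generating function of the walks from `0` to `a`, by half the number of steps beyond the
least possible number. -/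
noncomputable def walkSeries (L a : ℕ) : ℚ⟦X⟧ :=
  PowerSeries.mk fun n => (walkCount L (2 * n + a) a : ℚ)

theorem walkSeries_zero (hL : 2 ≤ L) :
    walkSeries L 0 = 1 + PowerSeries.X * walkSeries L 1 := by
  ext n
  rcases n with _ | n
  · simp [walkSeries, walkCount_zero]
  · rw [map_add, PowerSeries.coeff_succ_X_mul, PowerSeries.coeff_one, if_neg (by omega), zero_add,
      walkSeries, walkSeries, PowerSeries.coeff_mk, PowerSeries.coeff_mk,
      show 2 * (n + 1) + 0 = (2 * n + 1) + 1 by omega, walkCount_succ hL (by omega),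
      sum_nbr_zero hL]

theorem walkSeries_succ (hL : 2 ≤ L) {a : ℕ} (ha : a + 1 < L) :
    walkSeries L (a + 1) = walkSeries L a + PowerSeries.X * walkSeries L (a + 2) := by
  have h : ∀ k, walkCount L (k + 1) (a + 1) = walkCount L k a + walkCount L k (a + 2) := fun k => by
    rw [walkCount_succ hL ha, sum_nbr_succ ha _ (walkCount_of_ge hL le_rfl)]
  ext n
  rcases n with _ | n
  · simp only [walkSeries, map_add, PowerSeries.coeff_mk, PowerSeries.coeff_zero_X_mul]
    rw [← add_assoc, h, walkCount_of_lt (a := a + 2) (by omega)]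
    simp
  · rw [map_add, PowerSeries.coeff_succ_X_mul]
    simp only [walkSeries, PowerSeries.coeff_mk]
    rw [← add_assoc, h, Nat.cast_add, show 2 * (n + 1) + a = 2 * n + (a + 2) by omega]

/-- The placeholder `p 0 = 0` extends the recursion to `i = 0`. -/
theorem pSeries_add_two (i : ℕ) :
    pSeries (i + 2) = pSeries (i + 1) - PowerSeries.X * pSeries i := by
  rcases i with _ | i
  · simp [pSeries, p]
  · simp [pSeries, p]

theorem pSeries_zero : pSeries 0 = 0 := by simp [pSeries, p]

theorem pSeries_one : pSeries 1 = 1 := by simp [pSeries, p]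

/-- Both sides obey the same three-term recursion in `a`; two consecutive identities are carried for
the induction. At the index `L`, where the walk series vanishes, the identity determines `walkSeries
L 0`. -/
theorem X_pow_mul_walkSeries (hL : 2 ≤ L) (a : ℕ) (ha : a + 1 ≤ L) :
    PowerSeries.X ^ a * walkSeries L a = pSeries (a + 1) * walkSeries L 0 - pSeries a ∧
    PowerSeries.X ^ (a + 1) * walkSeries L (a + 1) =
      pSeries (a + 2) * walkSeries L 0 - pSeries (a + 1) := by
  induction a with
  | zero =>
    refine ⟨by simp [pSeries_zero, pSeries_one], ?_⟩
    have h2 : pSeries 2 = 1 := by simp [pSeries, p]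
    simp only [zero_add, pow_one, pSeries_one, h2]
    rw [walkSeries_zero hL]
    ring
  | succ a ih =>
    obtain ⟨h1, h2⟩ := ih (by omega)
    refine ⟨h2, ?_⟩
    have h3 := walkSeries_succ hL (a := a) (by omega)
    rw [pSeries_add_two (a + 1)]
    have e1 := pSeries_add_two a
    linear_combination h2 - PowerSeries.X * h1 - PowerSeries.X ^ (a + 1) * h3 + e1

theorem mk_walkCount (hL : 2 ≤ L) :
    PowerSeries.mk (fun n : ℕ => (walkCount L (2 * (n + 1)) 0 : ℚ)) =
      pSeries (L - 1) * (pSeries (L + 1))⁻¹ := by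
  obtain ⟨m, rfl⟩ := Nat.exists_eq_add_of_le' hL
  rw [PowerSeries.eq_mul_inv_iff_mul_eq (by rw [constantCoeff_pSeries]; exact one_ne_zero)]
  have h := (X_pow_mul_walkSeries hL (m + 1) le_rfl).2
  have h0 : walkSeries (m + 2) (m + 2) = 0 := by
    ext n
    simp [walkSeries, walkCount_of_ge hL]
  have h1 : walkSeries (m + 2) 0 = 1 + PowerSeries.X *
      PowerSeries.mk (fun n : ℕ => (walkCount (m + 2) (2 * (n + 1)) 0 : ℚ)) := by
    ext n
    rcases n with _ | n
    · simp [walkSeries, walkCount_zero]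
    · rw [map_add, PowerSeries.coeff_succ_X_mul]
      simp [walkSeries, PowerSeries.coeff_one]
  rw [show m + 1 + 1 = m + 2 from rfl, h0, h1] at h
  have h2 := pSeries_add_two (m + 1)
  -- The series wanted is the closed-walk series without its constant term, divided by `X`. One
  -- further use of the recursion turns the numerator `p L - p (L + 1)` into `X * p (L - 1)`.
  refine mul_left_cancel₀ (PowerSeries.X_ne_zero (R := ℚ)) ?_
  rw [show m + 2 - 1 = m + 1 by omega]
  rw [show m + 1 + 2 = m + 2 + 1 from rfl, show m + 1 + 1 = m + 2 from rfl] at *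
  linear_combination -h - h2

end Counting

/-! ### Quantum integers -/

section Main

/-- The quantum integer `[a + 1]`. -/
noncomputable def quantumInt (q : ℂ) : ℕ → ℂ
  | 0 => 1
  | 1 => q + q⁻¹
  | a + 2 => (q + q⁻¹) * quantumInt q (a + 1) - quantumInt q a

theorem sub_mul_quantumInt {q : ℂ} (hq : q ≠ 0) (a : ℕ) :
    (q - q⁻¹) * quantumInt q a = q ^ (a + 1) - q⁻¹ ^ (a + 1) ∧
    (q - q⁻¹) * quantumInt q (a + 1) = q ^ (a + 2) - q⁻¹ ^ (a + 2) := by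
  have hqq := mul_inv_cancel₀ hq
  induction a with
  | zero =>
    refine ⟨by simp [quantumInt], ?_⟩
    simp only [quantumInt]
    ring
  | succ a ih =>
    refine ⟨ih.2, ?_⟩
    rw [quantumInt]
    linear_combination (q + q⁻¹) * ih.2 - ih.1 + (q ^ (a + 1) - q⁻¹ ^ (a + 1)) * hqq

/-- As $q\ne q^{-1}$, vanishing means $q^{a+1}=q^{-(a+1)}$, that is, $(q^2)^{a+1}=1$. -/
theorem quantumInt_eq_zero_iff {q : ℂ} {l : ℕ} (hl : 3 ≤ l) (hq : orderOf (q ^ 2) = l) (a : ℕ) :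
    quantumInt q a = 0 ↔ l ∣ a + 1 := by
  have hq0 : q ≠ 0 := by
    rintro rfl
    rw [zero_pow two_ne_zero, orderOf_zero] at hq
    omega
  have hq1 : q ^ 2 ≠ 1 := by
    intro h
    rw [h, orderOf_one] at hq
    omega
  have hsub : q - q⁻¹ ≠ 0 := by
    intro h
    apply hq1
    linear_combination q * h + mul_inv_cancel₀ hq0
  have h := (sub_mul_quantumInt hq0 a).1
  rw [← hq, orderOf_dvd_iff_pow_eq_one, ← mul_right_inj' hsub, mul_zero, h, sub_eq_zero, inv_pow,
    ← mul_eq_one_iff_eq_inv₀ (pow_ne_zero _ hq0), ← sq, ← pow_mul, ← pow_mul, mul_comm 2]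

theorem isEigenweight_quantumInt {q : ℂ} {l : ℕ} (hl : 3 ≤ l) (hq : orderOf (q ^ 2) = l) :
    IsEigenweight (q + q⁻¹) (l - 1) (quantumInt q) where
  ne_zero a ha h := by
    have := Nat.le_of_dvd (by omega) ((quantumInt_eq_zero_iff hl hq a).1 h)
    omega
  sum_nbr a ha := by
    rcases a with _ | a
    · rw [sum_nbr_zero (by omega)]
      simp [quantumInt]
    -- The vanishing of $[\ell]$ is the boundary condition at the far end of the path graph.
    · rw [sum_nbr_succ ha _ ((quantumInt_eq_zero_iff hl hq _).2 (by
        rw [Nat.sub_add_cancel (by omega)]))]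
      rw [quantumInt]
      ring

/-! ### The Temperley-Lieb algebra and its Jones quotient -/

/-- The generators of `TL_n(q)` as a family indexed by natural numbers. -/
noncomputable def genFamily (q : ℂ) (n i : ℕ) : TL q n :=
  if h : i < n - 1 then gen q n ⟨i, h⟩ else 0

theorem genFamily_of_lt {q : ℂ} {n i : ℕ} (h : i < n - 1) :
    genFamily q n i = gen q n ⟨i, h⟩ := dif_pos h

theorem isTLFamily_genFamily (q : ℂ) (n : ℕ) : IsTLFamily (q + q⁻¹) n (genFamily q n) where
  sq i hi := by
    rw [genFamily_of_lt (by omega), gen_sq]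
  braid_up i hi := by
    rw [genFamily_of_lt (show i < n - 1 by omega), genFamily_of_lt (show i + 1 < n - 1 by omega),
      gen_braid _ _ _ _ (Or.inl rfl)]
  braid_down i hi := by
    rw [genFamily_of_lt (show i < n - 1 by omega), genFamily_of_lt (show i + 1 < n - 1 by omega),
      gen_braid _ _ _ _ (Or.inr rfl)]
  comm i j hij hj := by
    rw [genFamily_of_lt (show i < n - 1 by omega), genFamily_of_lt (show j < n - 1 by omega),
      gen_comm _ _ _ _ (Or.inl hij)]

theorem IsTLFamily.map {A A' : Type*} [Ring A] [Algebra ℂ A] [Ring A'] [Algebra ℂ A'] {d : ℂ}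
    {N : ℕ} {f : ℕ → A} (hf : IsTLFamily d N f) (g : A →ₐ[ℂ] A') :
    IsTLFamily d N (fun i => g (f i)) where
  sq i hi := by rw [← map_mul, hf.sq i hi, map_smul]
  braid_up i hi := by rw [← map_mul, ← map_mul, hf.braid_up i hi]
  braid_down i hi := by rw [← map_mul, ← map_mul, hf.braid_down i hi]
  comm i j hij hj := by rw [← map_mul, ← map_mul, hf.comm i j hij hj]

/-- The homomorphism from the Temperley-Lieb algebra determined by a family of elements satisfying
its relations. -/
noncomputable def liftFamily {A : Type*} [Ring A] [Algebra ℂ A] {q : ℂ} {n : ℕ} {f : ℕ → A}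
    (hf : IsTLFamily (q + q⁻¹) n f) : TL q n →ₐ[ℂ] A :=
  RingQuot.liftAlgHom ℂ ⟨FreeAlgebra.lift ℂ (fun i : Fin (n - 1) => f i), by
    intro x y hxy
    cases hxy with
    | sq i => simpa using hf.sq i (by omega)
    | braid i j hij =>
      rcases hij with h | h
      · simpa [← h] using hf.braid_up i (by omega)
      · simpa [← h] using hf.braid_down j (by omega)
    | comm i j hij =>
      rcases hij with h | h
      · simpa using hf.comm i j h (by omega)
      · simpa using (hf.comm j i h (by omega)).symm⟩

theorem liftFamily_genFamily {A : Type*} [Ring A] [Algebra ℂ A] {q : ℂ} {n : ℕ} {f : ℕ → A}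
    (hf : IsTLFamily (q + q⁻¹) n f) {i : ℕ} (hi : i + 2 ≤ n) :
    liftFamily hf (genFamily q n i) = f i := by
  rw [genFamily_of_lt (by omega)]
  simp [liftFamily, gen]

theorem strands_genFamily (q : ℂ) (n : ℕ) : strands (genFamily q n) n = ⊤ := by
  have h : (⊤ : Subalgebra ℂ (TL q n)) =
      (Algebra.adjoin ℂ (Set.range (FreeAlgebra.ι ℂ (X := Fin (n - 1))))).map
        (RingQuot.mkAlgHom ℂ (Rel q n)) := by
    rw [FreeAlgebra.adjoin_range_ι, Algebra.map_top]
    exact ((AlgHom.range_eq_top _).2 (RingQuot.mkAlgHom_surjective ℂ (Rel q n))).symm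
  rw [eq_top_iff, h, AlgHom.map_adjoin, Algebra.adjoin_le_iff]
  rintro _ ⟨_, ⟨i, rfl⟩, rfl⟩
  have e : genFamily q n i = RingQuot.mkAlgHom ℂ (Rel q n) (FreeAlgebra.ι ℂ i) :=
    genFamily_of_lt i.2
  rw [SetLike.mem_coe, ← e]
  exact mem_strands (by omega)

theorem isTLFamily_zero (d : ℂ) (N : ℕ) : IsTLFamily d N (fun _ => (0 : ℂ)) := by
  constructor <;> simp

theorem IsJonesWenzl.genFamily_mul {q : ℂ} {n : ℕ} {E : TL q n} (hE : IsJonesWenzl q n E) (i : ℕ)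
    (hi : i + 2 ≤ n) : genFamily q n i * E = 0 := by
  rw [genFamily_of_lt (by omega), hE.gen_mul]

/-- The Jones-Wenzl idempotent is unique, and congruent to `1` modulo the products through the last
generator. -/
theorem exists_isJonesWenzl {q : ℂ} {n : ℕ} (hw : ∀ a < n, quantumInt q a ≠ 0) :
    ∃ E : TL q n, IsJonesWenzl q n E ∧ E - 1 ∈ bridge (genFamily q n) n ∧
      ∀ E', IsJonesWenzl q n E' → E' = E := by
  have hf := isTLFamily_genFamily q n
  obtain ⟨E, -, hE1, hEE, hl, hr⟩ := hf.exists_jonesWenzl (w := quantumInt q) rfl rfl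
    (fun _ => rfl) le_rfl hw
  -- The character sending every generator to zero kills the bridge, so it maps `E` to `1`.
  have hE0 : E ≠ 0 := by
    rintro rfl
    have h := map_mem_bridge (f' := fun _ => (0 : ℂ)) (liftFamily (isTLFamily_zero (q + q⁻¹) n))
      (fun i hi => liftFamily_genFamily _ hi) hE1
    have h0 : bridge (fun _ => (0 : ℂ)) n = ⊥ := by
      rw [bridge, Submodule.span_eq_bot]
      rintro _ ⟨i, x, y, -, -, -, rfl⟩
      simp
    rw [h0, Submodule.mem_bot] at h
    simp at h
  refine ⟨E, ⟨hE0, hEE, fun i => ?_, fun i => ?_⟩, hE1, fun E' hE' => ?_⟩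
  · have := hl i (by omega)
    rwa [genFamily_of_lt i.2] at this
  · have := hr i (by omega)
    rwa [genFamily_of_lt i.2] at this
  -- The product `E * E'` equals `E'` and is also a multiple of `E`; idempotency then forces the
  -- multiple to be `1`.
  · have h1 : E * E' = E' := by
      have := bridge_mul_eq_zero hE'.genFamily_mul hE1
      rwa [sub_mul, one_mul, sub_eq_zero] at this
    obtain ⟨c, hc⟩ := exists_mul_eq_smul' (b := E') hr (strands_genFamily q n ▸ Algebra.mem_top)
    rw [h1] at hc
    have hc0 : c ≠ 0 := by
      rintro rfl
      exact hE'.ne_zero (by rw [hc, zero_smul])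
    have h2 := hE'.idem
    rw [hc, smul_mul_smul_comm, hEE] at h2
    have h3 : c * c = c := smul_left_injective ℂ hE0 h2
    rw [hc, mul_left_cancel₀ hc0 (h3.trans (mul_one c).symm), one_smul]

/-! ### Faithful path representation of the Jones algebra and its dimension -/

variable {q : ℂ} {l : ℕ}

/-- The action of the Temperley-Lieb algebra on functions of walks. -/
noncomputable def pathRep (hl : 3 ≤ l) (hq : orderOf (q ^ 2) = l) (n : ℕ) :
    TL q n →ₐ[ℂ] Module.End ℂ (LatticePath (l - 1) → ℂ) :=
  liftFamily (isTLFamily_pathOp (isEigenweight_quantumInt hl hq) n)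

theorem pathRep_genFamily (hl : 3 ≤ l) (hq : orderOf (q ^ 2) = l) {n i : ℕ} (hi : i + 2 ≤ n) :
    pathRep hl hq n (genFamily q n i) = pathOp (l - 1) (quantumInt q) i :=
  liftFamily_genFamily _ hi

theorem incl_genFamily {m n i : ℕ} (h : m ≤ n) (hi : i + 2 ≤ m) :
    incl q h (genFamily q m i) = genFamily q n i := by
  rw [genFamily_of_lt (by omega), incl_gen, genFamily_of_lt (by omega)]
  rfl

theorem pathRep_incl (hl : 3 ≤ l) (hq : orderOf (q ^ 2) = l) {n : ℕ} (h : l - 1 ≤ n)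
    {E : TL q (l - 1)} (hE : IsJonesWenzl q (l - 1) E) : pathRep hl hq n (incl q h E) = 0 := by
  have h1 := one_mem_bridge_pathOp (show 2 ≤ l - 1 by omega) (isEigenweight_quantumInt hl hq)
  have h2 := bridge_mul_eq_zero (E := pathRep hl hq n (incl q h E)) (fun i hi => by
    rw [← pathRep_genFamily hl hq (n := n) (by omega), ← incl_genFamily h hi, ← map_mul, ← map_mul,
      hE.genFamily_mul i hi, map_zero, map_zero]) h1
  rwa [one_mul] at h2

theorem pathRep_jonesIdeal (hl : 3 ≤ l) (hq : orderOf (q ^ 2) = l) (n : ℕ) :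
    ∀ a ∈ (jonesIdeal q l n).asIdeal, pathRep hl hq n a = 0 := by
  intro a ha
  rw [TwoSidedIdeal.mem_asIdeal] at ha
  suffices H : jonesIdeal q l n ≤ TwoSidedIdeal.ker (pathRep hl hq n) from
    (TwoSidedIdeal.mem_ker _).1 (H ha)
  refine TwoSidedIdeal.span_le.2 ?_
  rintro _ ⟨h, E, hE, rfl⟩
  exact (TwoSidedIdeal.mem_ker _).2 (pathRep_incl hl hq h hE)

/-- The action of the Jones algebra on functions of walks. -/
noncomputable def jonesRep (hl : 3 ≤ l) (hq : orderOf (q ^ 2) = l) (n : ℕ) :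
    JonesAlgebra q l n →ₐ[ℂ] Module.End ℂ (LatticePath (l - 1) → ℂ) :=
  Ideal.Quotient.liftₐ _ (pathRep hl hq n) (pathRep_jonesIdeal hl hq n)

/-- The generators of the Jones algebra. -/
noncomputable def jonesFamily (q : ℂ) (l n i : ℕ) : JonesAlgebra q l n :=
  Ideal.Quotient.mkₐ ℂ (jonesIdeal q l n).asIdeal (genFamily q n i)

theorem isTLFamily_jonesFamily (q : ℂ) (l n : ℕ) :
    IsTLFamily (q + q⁻¹) n (jonesFamily q l n) :=
  (isTLFamily_genFamily q n).map _

theorem strands_jonesFamily (q : ℂ) (l n : ℕ) : strands (jonesFamily q l n) n = ⊤ := by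
  rw [← map_strands (Ideal.Quotient.mkₐ ℂ (jonesIdeal q l n).asIdeal)
    (f := genFamily q n) (f' := jonesFamily q l n) (fun i _ => rfl), strands_genFamily, Algebra.map_top]
  exact (AlgHom.range_eq_top _).2 (Ideal.Quotient.mkₐ_surjective ℂ _)

theorem jonesRep_jonesFamily (hl : 3 ≤ l) (hq : orderOf (q ^ 2) = l) {n i : ℕ} (hi : i + 2 ≤ n) :
    jonesRep hl hq n (jonesFamily q l n i) = pathOp (l - 1) (quantumInt q) i :=
  pathRep_genFamily hl hq hi

/-- In the quotient `E` becomes zero, so `E - 1`, which lies in the bridge, becomes `-1`. -/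
theorem one_mem_bridge_jonesFamily (hl : 3 ≤ l) (hq : orderOf (q ^ 2) = l) {n : ℕ}
    (h : l - 1 ≤ n) : 1 ∈ bridge (jonesFamily q l n) (l - 1) := by
  obtain ⟨E, hE, hE1, -⟩ := exists_isJonesWenzl (isEigenweight_quantumInt hl hq).ne_zero
  have h0 : Ideal.Quotient.mkₐ ℂ (jonesIdeal q l n).asIdeal (incl q h E) = 0 := by
    rw [Ideal.Quotient.mkₐ_eq_mk, Ideal.Quotient.eq_zero_iff_mem, TwoSidedIdeal.mem_asIdeal]
    exact TwoSidedIdeal.subset_span ⟨h, E, hE, rfl⟩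
  have h1 := map_mem_bridge (f' := jonesFamily q l n)
    ((Ideal.Quotient.mkₐ ℂ (jonesIdeal q l n).asIdeal).comp (incl q h))
    (fun i hi => by rw [AlgHom.comp_apply, incl_genFamily h hi]; rfl) hE1
  rw [map_sub, map_one, AlgHom.comp_apply, h0, zero_sub] at h1
  simpa using neg_mem h1

theorem jonesRep_injective (hl : 3 ≤ l) (hq : orderOf (q ^ 2) = l) (n : ℕ) :
    Function.Injective (jonesRep hl hq n) := by
  rw [injective_iff_map_eq_zero]
  intro b hb
  exact eq_zero_of_map_eq_zero (isTLFamily_jonesFamily q l n) (by omega)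
    (isEigenweight_quantumInt hl hq) rfl rfl (fun _ => rfl)
    (fun h => one_mem_bridge_jonesFamily hl hq h) (jonesRep hl hq n)
    (fun i hi => jonesRep_jonesFamily hl hq hi) le_rfl
    (strands_jonesFamily q l n ▸ Algebra.mem_top) hb

theorem range_jonesRep (hl : 3 ≤ l) (hq : orderOf (q ^ 2) = l) (n : ℕ) :
    LinearMap.range (jonesRep hl hq n).toLinearMap =
      Submodule.span ℂ (Set.range (matUnits (l - 1) n)) := by
  rw [← toSubmodule_strands_pathOp (by omega) (isEigenweight_quantumInt hl hq),
    ← map_strands (jonesRep hl hq n) (f := jonesFamily q l n)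
      (fun i hi => jonesRep_jonesFamily hl hq hi), strands_jonesFamily, Algebra.map_top]
  rfl

/-- The Jones algebra is isomorphic, as a vector space, to the span of the matrix units. -/
noncomputable def jonesEquiv (hl : 3 ≤ l) (hq : orderOf (q ^ 2) = l) (n : ℕ) :
    JonesAlgebra q l n ≃ₗ[ℂ] Submodule.span ℂ (Set.range (matUnits (l - 1) n)) :=
  (LinearEquiv.ofInjective (jonesRep hl hq n).toLinearMap (jonesRep_injective hl hq n)).trans
    (LinearEquiv.ofEq _ _ (range_jonesRep hl hq n))

theorem finite_jonesAlgebra (hl : 3 ≤ l) (hq : orderOf (q ^ 2) = l) (n : ℕ) :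
    Module.Finite ℂ (JonesAlgebra q l n) :=
  have := FiniteDimensional.span_of_finite ℂ (Set.finite_range (matUnits (l - 1) n))
  Module.Finite.equiv (jonesEquiv hl hq n).symm

theorem finrank_jonesAlgebra (hl : 3 ≤ l) (hq : orderOf (q ^ 2) = l) (n : ℕ) :
    Module.finrank ℂ (JonesAlgebra q l n) = walkCount (l - 1) (2 * n) 0 := by
  rw [(jonesEquiv hl hq n).finrank_eq,
    finrank_span_eq_card (linearIndependent_matUnits (by omega) n), Fintype.card_coe,
    card_walkPairs (by omega)]

end Main

end TemperleyLieb

theorem mainTheorem5 (q : ℂ) (l : ℕ) (hl : 3 ≤ l) (hq : orderOf (q ^ 2) = l) :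
    (∃! E : TemperleyLieb.TL q (l - 1), TemperleyLieb.IsJonesWenzl q (l - 1) E) ∧
    (∀ n : ℕ, Module.Finite ℂ (TemperleyLieb.JonesAlgebra q l n)) ∧
    PowerSeries.mk
        (fun n : ℕ => (Module.finrank ℂ (TemperleyLieb.JonesAlgebra q l (n + 1)) : ℚ)) =
      TemperleyLieb.pSeries (l - 2) * (TemperleyLieb.pSeries l)⁻¹ := by
  obtain ⟨E, hE, -, huniq⟩ := TemperleyLieb.exists_isJonesWenzl
    (TemperleyLieb.isEigenweight_quantumInt hl hq).ne_zero
  refine ⟨⟨E, hE, huniq⟩, TemperleyLieb.finite_jonesAlgebra hl hq, ?_⟩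
  have h := TemperleyLieb.mk_walkCount (L := l - 1) (by omega)
  rw [show l - 1 - 1 = l - 2 by omega, show l - 1 + 1 = l by omega] at h
  simp only [TemperleyLieb.finrank_jonesAlgebra hl hq]
  exact h
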